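/- Let $k$ be a field. An endomorphism of $\mathbb{A}^3=\mathbb{A}^3_k$ is a triple $f=(f_1,f_2,f_3)$ of polynomials in $k[x_1,x_2,x_3]$; endomorphisms form a monoid under composition, whose invertible elements are the automorphisms of $\mathbb{A}^3$. Put $\deg f=\max(\deg f_1,\deg f_2,\deg f_3)$. The dynamical degree of an automorphism $f$ is $\lambda(f)=\lim_{r\to\infty}\deg(f^r)^{1/r}$ (the limit exists). An endomorphism is triangular if $f_i\in k[x_1,\dots,x_i]$ for $i=1,2,3$; an affine automorphism is an automorphism of degree $1$; and $f$ is affine-triangular if $f=\alpha\circ\tau$ with $\alpha$ an affine automorphism and $\tau$ a triangular endomorphism. For each field $k$ and each integer $d\ge 2$, the set of dynamical degrees of all affine-triangular automorphisms of $\mathbb{A}^3_k$ of degree $\le d$ is equal to \[ \left\{\frac{a+\sqrt{a^2+4bc}}{2}\;\middle|\;(a,b,c)\in\mathbb{N}^3,\ a+b\le d,\ c\le d\right\}\setminus\{0\}, \] where $\mathbb{N}=\{0,1,2,\dots\}$. Moreover, for all $a,b,c\in\mathbb{N}$ such that $\lambda=\frac{a+\sqrt{a^2+4bc}}{2}\neq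 0$, both \[ (x_3+x_1^ax_2^b,\;x_2+x_1^c,\;x_1)\quad\text{and}\quad(x_3+x_1^ax_2^{bc},\;x_1,\;x_2) \] are affine-triangular automorphisms of $\mathbb{A}^3_k$ with dynamical degree $\lambda$. -/

import Mathlib

/-- A polynomial endomorphism `(f₁, …, fₙ)` of affine `n`-space over `k`. The coordinates are
indexed from `0`: `coord 0` is `f₁`, and `MvPolynomial.X 0` is `x₁`. -/
@[ext]
structure PolyEnd (k : Type*) [Field k] (n : ℕ) where
  coord : Fin n → MvPolynomial (Fin n) k

namespace PolyEnd

variable {k : Type*} [Field k] {n : ℕ}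

/-- The monoid of polynomial endomorphisms under composition:
`(f * g)ᵢ = fᵢ(g₁, …, gₙ)` and `1 = (x₁, …, xₙ)`.
Automorphisms of affine space are the invertible elements, `IsUnit f`. -/
noncomputable instance : Monoid (PolyEnd k n) where
  mul f g := ⟨fun i => MvPolynomial.bind₁ g.coord (f.coord i)⟩
  one := ⟨MvPolynomial.X⟩
  mul_assoc f g h := by
    apply PolyEnd.ext
    funext i
    exact MvPolynomial.bind₁_bind₁ g.coord h.coord (f.coord i)
  one_mul f := by
    apply PolyEnd.ext
    funext i
    exact MvPolynomial.bind₁_X_right f.coord i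
  mul_one f := by
    apply PolyEnd.ext
    funext i
    exact DFunLike.congr_fun MvPolynomial.bind₁_X_left (f.coord i)

/-- The degree `max (deg f₁, …, deg fₙ)`. -/
def degree (f : PolyEnd k n) : ℕ :=
  Finset.univ.sup fun i => (f.coord i).totalDegree

/-- `f` is triangular if `fᵢ ∈ k[x₁, …, xᵢ]` for each `i`. -/
def IsTriangular (f : PolyEnd k n) : Prop :=
  ∀ i, f.coord i ∈ MvPolynomial.supported k (Set.Iic i)

/-- An affine automorphism is an automorphism of degree `1`. -/
def IsAffineAut (f : PolyEnd k n) : Prop :=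
  IsUnit f ∧ f.degree = 1

/-- `f` is affine-triangular if `f = α ∘ τ` with `α` an affine automorphism and `τ` a triangular
endomorphism. -/
def IsAffineTriangular (f : PolyEnd k n) : Prop :=
  ∃ α τ : PolyEnd k n, α.IsAffineAut ∧ τ.IsTriangular ∧ f = α * τ

/-- The dynamical degree, the limit of `deg(f ^ r) ^ (1 / r)` as `r → ∞`; the limit exists for
every automorphism by `tendsto_dynamicalDegree`. -/
noncomputable def dynamicalDegree (f : PolyEnd k n) : ℝ :=
  Filter.limUnder Filter.atTop fun r : ℕ => ((f ^ r).degree : ℝ) ^ (1 / (r : ℝ))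

theorem totalDegree_coord_le (f : PolyEnd k n) (i : Fin n) :
    (f.coord i).totalDegree ≤ f.degree :=
  Finset.le_sup (f := fun i => (f.coord i).totalDegree) (Finset.mem_univ i)

theorem degree_mul_le (f g : PolyEnd k n) : (f * g).degree ≤ f.degree * g.degree := by
  refine Finset.sup_le fun i _ => ?_
  refine le_trans ?_ (Nat.mul_le_mul_right g.degree (f.totalDegree_coord_le i))
  change (MvPolynomial.bind₁ g.coord (f.coord i)).totalDegree ≤ _
  generalize f.coord i = p
  conv_lhs => rw [p.as_sum, map_sum]
  refine MvPolynomial.totalDegree_finsetSum_le fun s hs => ?_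
  rw [MvPolynomial.bind₁_monomial]
  refine (MvPolynomial.totalDegree_mul _ _).trans ?_
  rw [MvPolynomial.totalDegree_C, zero_add]
  refine (MvPolynomial.totalDegree_finsetProd _ _).trans ?_
  refine le_trans ?_ (Nat.mul_le_mul_right g.degree (MvPolynomial.le_totalDegree hs))
  rw [Finsupp.sum, Finset.sum_mul]
  refine Finset.sum_le_sum fun j _ => ?_
  exact (MvPolynomial.totalDegree_pow _ _).trans
    (Nat.mul_le_mul_left _ (g.totalDegree_coord_le j))

theorem one_le_degree (hn : 0 < n) {f : PolyEnd k n} (hf : IsUnit f) : 1 ≤ f.degree := by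
  obtain ⟨u, rfl⟩ := hf
  by_contra! h
  have h0 : (u : PolyEnd k n).degree = 0 := by lia
  have h1 := degree_mul_le (↑u⁻¹ : PolyEnd k n) (u : PolyEnd k n)
  rw [Units.inv_mul, h0, mul_zero] at h1
  have h2 := (totalDegree_coord_le (1 : PolyEnd k n) ⟨0, hn⟩).trans h1
  change (MvPolynomial.X _ : MvPolynomial (Fin n) k).totalDegree ≤ 0 at h2
  rw [MvPolynomial.totalDegree_X] at h2
  lia

/-- The limit that defines the dynamical degree exists for automorphisms. -/
theorem tendsto_dynamicalDegree (hn : 0 < n) {f : PolyEnd k n} (hf : IsUnit f) :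
    Filter.Tendsto (fun r : ℕ => ((f ^ r).degree : ℝ) ^ (1 / (r : ℝ))) Filter.atTop
      (nhds f.dynamicalDegree) := by
  have hpos : ∀ r : ℕ, (1 : ℝ) ≤ ((f ^ r).degree : ℝ) := fun r => by
    exact_mod_cast one_le_degree hn (hf.pow r)
  have hsub : Subadditive fun r : ℕ => Real.log ((f ^ r).degree : ℝ) := by
    intro r s
    rw [← Real.log_mul (by linarith [hpos r]) (by linarith [hpos s])]
    refine Real.log_le_log (by linarith [hpos (r + s)]) ?_
    rw [pow_add]
    exact_mod_cast degree_mul_le (f ^ r) (f ^ s)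
  have hbdd : BddBelow (Set.range fun r : ℕ => Real.log ((f ^ r).degree : ℝ) / r) := by
    refine ⟨0, ?_⟩
    rintro _ ⟨r, rfl⟩
    exact div_nonneg (Real.log_nonneg (hpos r)) (Nat.cast_nonneg r)
  have hlim := (Real.continuous_exp.tendsto _).comp (hsub.tendsto_lim hbdd)
  refine tendsto_nhds_limUnder ⟨Real.exp hsub.lim, hlim.congr fun r => ?_⟩
  rw [Real.rpow_def_of_pos (by linarith [hpos r])]
  simp [div_eq_mul_inv]

end PolyEnd

/-! Dynamical degrees are computed as eigenvalues for weighted degrees. Give the variables real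
weights `w`. If every coordinate satisfies `deg_w fᵢ ≤ θ wᵢ` and all weights are positive, iteration
gives `deg_w (f ^ r)ᵢ ≤ θ ^ r wᵢ`, hence `λ(f) ≤ θ` (`dynamicalDegree_le_of_weightIn`). Conversely,
let `gᵢ` be the part of `fᵢ` of weight exactly `θ wᵢ`. Leading parts are compatible with
composition, so if some coordinate of positive weight never vanishes in the iterates of `g`, then
`λ(f) ≥ θ` (`le_dynamicalDegree_of_isLead`). Nonvanishing is checked with a second, irrational
weight, under which the first two coordinates of `g` have leading monomials of independent weights
(`coord_zero_pow_ne_zero`).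

The central family is `(e x₃ + Q(x₁, x₂), η x₂ + p(x₁), a x₁ + b)` with `c = deg p ≥ 1`. The weights
`(θ, c, θ)` work when `θ` is the largest of `1` and the roots of `t² = i t + j c` over the monomials
`x₁^i x₂^j` of `Q`. If `p` is constant, the dynamical degree is the largest of `1` and the
`x₁`-degree of `Q`.

An affine-triangular automorphism reduces to these families. The linear part is `B P C` with `B`,
`C` lower triangular and `P` a permutation matrix; conjugation by `B` leaves `P` composed with a
triangular automorphism of no larger degree (`IsAffineTriangular.exists_conj`). Such an automorphism
has the form `(a₀ x₁ + b, a₁ x₂ + p(x₁), a₂ x₃ + q(x₁, x₂))` with nonzero `aᵢ`, and each of the six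
permutations is treated separately. The delicate one is the rotation in `isQuadratic_of_rotate`: it
is conjugate to a shift-like map whose degree may exceed `d`, so the exponents of the quadratic
equation have to be bounded through the original `p` and `q`.

The explicit examples lie in the two families and realize all the values. -/

namespace MvPolynomial

/-! ### Weighted degrees and leading parts -/

variable {σ ι k : Type*} [Field k]

/-- Every monomial of `p` has its `w`-weight in `S`. -/
def WeightIn (w : σ → ℝ) (S : Set ℝ) (p : MvPolynomial σ k) : Prop :=
  ∀ m ∈ p.support, Finsupp.weight w m ∈ S

/-- `G` is the part of `p` of `w`-weight `D`, and the rest of `p` has smaller weight.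
Here `G = 0` is allowed. -/
structure IsLead (w : σ → ℝ) (D : ℝ) (p G : MvPolynomial σ k) : Prop where
  homogeneous : WeightIn w {D} G
  rest : WeightIn w (Set.Iio D) (p - G)

variable {w : σ → ℝ} {S T U : Set ℝ} {D E : ℝ} {p q G H : MvPolynomial σ k}

theorem WeightIn.mono (h : WeightIn w S p) (hST : S ⊆ T) : WeightIn w T p :=
  fun m hm => hST (h m hm)

theorem weightIn_zero : WeightIn w S (0 : MvPolynomial σ k) := by
  intro m hm
  simp at hm

theorem WeightIn.add (hp : WeightIn w S p) (hq : WeightIn w S q) : WeightIn w S (p + q) := by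
  classical
  intro m hm
  rcases Finset.mem_union.1 (support_add hm) with h | h
  exacts [hp m h, hq m h]

theorem WeightIn.neg (hp : WeightIn w S p) : WeightIn w S (-p) := by
  intro m hm
  rw [support_neg] at hm
  exact hp m hm

theorem WeightIn.sub (hp : WeightIn w S p) (hq : WeightIn w S q) : WeightIn w S (p - q) := by
  rw [sub_eq_add_neg]
  exact hp.add hq.neg

theorem WeightIn.sum {s : Finset ι} {f : ι → MvPolynomial σ k}
    (h : ∀ i ∈ s, WeightIn w S (f i)) : WeightIn w S (∑ i ∈ s, f i) := by
  classical
  induction s using Finset.induction_on with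
  | empty => exact weightIn_zero
  | insert a s ha ih =>
    rw [Finset.sum_insert ha]
    exact (h a (Finset.mem_insert_self a s)).add
      (ih fun i hi => h i (Finset.mem_insert_of_mem hi))

theorem WeightIn.mul (hp : WeightIn w S p) (hq : WeightIn w T q)
    (hU : ∀ a ∈ S, ∀ b ∈ T, a + b ∈ U) : WeightIn w U (p * q) := by
  classical
  intro m hm
  obtain ⟨a, ha, b, hb, rfl⟩ := Finset.mem_add.1 (support_mul p q hm)
  rw [map_add]
  exact hU _ (hp a ha) _ (hq b hb)

theorem weightIn_monomial {m : σ →₀ ℕ} (a : k) (h : Finsupp.weight w m ∈ S) :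
    WeightIn w S (monomial m a) := by
  intro m' hm'
  have := support_monomial_subset hm'
  rw [Finset.mem_singleton] at this
  rwa [this]

theorem weightIn_C (a : k) (h : 0 ∈ S) : WeightIn w S (C a : MvPolynomial σ k) :=
  weightIn_monomial a (by simpa using h)

theorem weightIn_X (i : σ) (h : w i ∈ S) : WeightIn w S (X i : MvPolynomial σ k) :=
  weightIn_monomial 1 (by simpa [Finsupp.weight_single] using h)

theorem WeightIn.C_mul (hp : WeightIn w S p) (a : k) : WeightIn w S (C a * p) :=
  (weightIn_C (S := {0}) a rfl).mul hp fun x hx y hy => by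
    rw [Set.mem_singleton_iff.1 hx, zero_add]; exact hy

theorem weightIn_smul_iff {c : ℝ} (hc : 0 < c) :
    WeightIn (c • w) ((c * ·) '' S) p ↔ WeightIn w S p := by
  have key : ∀ m : σ →₀ ℕ, Finsupp.weight (c • w) m = c * Finsupp.weight w m := by
    intro m
    simp only [Finsupp.weight_apply, Finsupp.sum, Pi.smul_apply, smul_eq_mul, nsmul_eq_mul,
      Finset.mul_sum]
    exact Finset.sum_congr rfl fun i _ => by ring
  have hinj : Function.Injective (c * ·) := mul_right_injective₀ hc.ne'
  simp only [WeightIn, key]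
  exact forall₂_congr fun m _ => hinj.mem_set_image

/-- Used with `c = θ ^ r`: the `r`-th iterate has coordinates of weight `θ ^ r * w i`, so the next
composition needs the hypothesis for the rescaled weights. -/
theorem IsLead.smul_weight {c : ℝ} (hc : 0 < c) (h : IsLead w D p G) :
    IsLead (c • w) (c * D) p G := by
  refine ⟨((weightIn_smul_iff hc).2 h.1).mono ?_, ((weightIn_smul_iff hc).2 h.2).mono ?_⟩
  · rintro _ ⟨x, hx, rfl⟩
    rw [Set.mem_singleton_iff.1 hx]
    rfl
  · rintro _ ⟨x, hx, rfl⟩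
    exact mul_lt_mul_of_pos_left hx hc

theorem WeightIn.smul_weight {c : ℝ} (hc : 0 < c) (h : WeightIn w (Set.Iic D) p) :
    WeightIn (c • w) (Set.Iic (c * D)) p := by
  refine ((weightIn_smul_iff hc).2 h).mono ?_
  rintro _ ⟨x, hx, rfl⟩
  exact mul_le_mul_of_nonneg_left hx hc.le

theorem IsLead.weightIn (h : IsLead w D p G) : WeightIn w (Set.Iic D) p := by
  rw [← sub_add_cancel p G]
  exact (h.2.mono Set.Iio_subset_Iic_self).add (h.1.mono (by simp))

theorem WeightIn.isLead_zero (h : WeightIn w (Set.Iio D) p) : IsLead w D p 0 :=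
  ⟨weightIn_zero, by simpa using h⟩

theorem WeightIn.isLead_self (h : WeightIn w {D} p) : IsLead w D p p :=
  ⟨h, by simpa using weightIn_zero⟩

theorem isLead_C (a : k) : IsLead w 0 (C a) (C a) := (weightIn_C a (Set.mem_singleton _)).isLead_self

theorem isLead_monomial (m : σ →₀ ℕ) (a : k) :
    IsLead w (Finsupp.weight w m) (monomial m a) (monomial m a) :=
  (weightIn_monomial a (Set.mem_singleton _)).isLead_self

theorem isLead_X (i : σ) : IsLead w (w i) (X i : MvPolynomial σ k) (X i) :=
  (weightIn_X i (Set.mem_singleton _)).isLead_self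

theorem IsLead.add (hp : IsLead w D p G) (hq : IsLead w D q H) : IsLead w D (p + q) (G + H) :=
  ⟨hp.1.add hq.1, by rw [add_sub_add_comm]; exact hp.2.add hq.2⟩

theorem IsLead.add_lt (hp : IsLead w D p G) (hq : WeightIn w (Set.Iio D) q) :
    IsLead w D (p + q) G := by
  simpa using hp.add hq.isLead_zero

theorem IsLead.mul (hp : IsLead w D p G) (hq : IsLead w E q H) :
    IsLead w (D + E) (p * q) (G * H) := by
  refine ⟨hp.1.mul hq.1 fun a ha b hb => by
    rw [Set.mem_singleton_iff.1 ha, Set.mem_singleton_iff.1 hb]; rfl, ?_⟩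
  have : p * q - G * H = (p - G) * q + G * (q - H) := by ring
  rw [this]
  refine (hp.2.mul hq.weightIn fun a ha b hb => Set.mem_Iio.2 (add_lt_add_of_lt_of_le ha hb)).add
    (hp.1.mul hq.2 fun a ha b hb => ?_)
  rw [Set.mem_singleton_iff.1 ha]
  exact add_lt_add_right hb D

theorem IsLead.pow (hp : IsLead w D p G) (n : ℕ) : IsLead w (n * D) (p ^ n) (G ^ n) := by
  induction n with
  | zero => simpa using isLead_C (1 : k)
  | succ n ih =>
    rw [pow_succ, pow_succ, Nat.cast_succ, add_mul, one_mul]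
    exact ih.mul hp

theorem IsLead.prod {s : Finset ι} {f g : ι → MvPolynomial σ k} {d : ι → ℝ}
    (h : ∀ i ∈ s, IsLead w (d i) (f i) (g i)) :
    IsLead w (∑ i ∈ s, d i) (∏ i ∈ s, f i) (∏ i ∈ s, g i) := by
  classical
  induction s using Finset.induction_on with
  | empty => simpa using isLead_C (1 : k)
  | insert a s ha ih =>
    rw [Finset.sum_insert ha, Finset.prod_insert ha, Finset.prod_insert ha]
    exact (h a (Finset.mem_insert_self a s)).mul
      (ih fun i hi => h i (Finset.mem_insert_of_mem hi))

section Bind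

variable {v : ι → ℝ} {f g : ι → MvPolynomial σ k}

theorem IsLead.bind₁_monomial (h : ∀ i, IsLead w (v i) (f i) (g i)) (m : ι →₀ ℕ) (a : k) :
    IsLead w (Finsupp.weight v m) (bind₁ f (monomial m a)) (bind₁ g (monomial m a)) := by
  rw [MvPolynomial.bind₁_monomial, MvPolynomial.bind₁_monomial, Finsupp.weight_apply,
    Finsupp.sum, ← zero_add (Finset.sum _ _)]
  refine (isLead_C a).mul (IsLead.prod fun i _ => ?_)
  rw [nsmul_eq_mul]
  exact (h i).pow _

theorem WeightIn.pow_Iic (hp : WeightIn w (Set.Iic D) p) (n : ℕ) :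
    WeightIn w (Set.Iic (n * D)) (p ^ n) := by
  induction n with
  | zero => simpa using weightIn_C (w := w) (S := Set.Iic 0) (1 : k) (by simp)
  | succ n ih =>
    rw [pow_succ, Nat.cast_succ, add_mul, one_mul]
    exact ih.mul hp fun a ha b hb => Set.mem_Iic.2 (add_le_add ha hb)

theorem WeightIn.prod_Iic {s : Finset ι} {d : ι → ℝ}
    (h : ∀ i ∈ s, WeightIn w (Set.Iic (d i)) (f i)) :
    WeightIn w (Set.Iic (∑ i ∈ s, d i)) (∏ i ∈ s, f i) := by
  classical
  induction s using Finset.induction_on with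
  | empty => simpa using weightIn_C (w := w) (S := Set.Iic 0) (1 : k) (by simp)
  | insert a s ha ih =>
    rw [Finset.sum_insert ha, Finset.prod_insert ha]
    exact (h a (Finset.mem_insert_self a s)).mul
      (ih fun i hi => h i (Finset.mem_insert_of_mem hi)) fun a ha b hb => Set.mem_Iic.2 (add_le_add ha hb)

/-- The general lower set covers strict and non-strict bounds at once; both `Set.Iio D` and `Set.Iic
D` occur later. -/
theorem WeightIn.bind₁ {P : MvPolynomial ι k} (hP : WeightIn v S P) (hS : IsLowerSet S)
    (h : ∀ i, WeightIn w (Set.Iic (v i)) (f i)) : WeightIn w S (bind₁ f P) := by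
  rw [P.as_sum, map_sum]
  refine WeightIn.sum fun m hm => ?_
  rw [MvPolynomial.bind₁_monomial]
  refine WeightIn.C_mul ?_ _
  refine WeightIn.mono (S := Set.Iic (Finsupp.weight v m)) ?_ fun x hx => hS hx (hP m hm)
  rw [Finsupp.weight_apply, Finsupp.sum]
  refine WeightIn.prod_Iic fun i _ => ?_
  rw [nsmul_eq_mul]
  exact (h i).pow_Iic _

/-- No cancellation hypothesis is needed because a leading part may be `0`. Thus iterates of the
leading part control iterates of the map, and nonvanishing becomes a separate question. -/
theorem IsLead.bind₁ {P Q : MvPolynomial ι k} (hP : IsLead v D P Q)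
    (h : ∀ i, IsLead w (v i) (f i) (g i)) : IsLead w D (bind₁ f P) (bind₁ g Q) := by
  have hQ : IsLead w D (MvPolynomial.bind₁ f Q) (MvPolynomial.bind₁ g Q) := by
    have hm : ∀ m ∈ Q.support, IsLead w D (MvPolynomial.bind₁ f (monomial m (coeff m Q)))
        (MvPolynomial.bind₁ g (monomial m (coeff m Q))) := fun m hm => by
      have := IsLead.bind₁_monomial h m (coeff m Q)
      rwa [hP.1 m hm] at this
    rw [Q.as_sum]
    simp only [map_sum]
    refine ⟨WeightIn.sum fun m hm' => (hm m hm').1, ?_⟩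
    rw [← Finset.sum_sub_distrib]
    exact WeightIn.sum fun m hm' => (hm m hm').2
  have hR := hP.2.bind₁ (isLowerSet_Iio D) fun i => (h i).weightIn
  rw [map_sub] at hR
  have := hQ.add_lt hR
  rwa [add_sub_cancel] at this

end Bind

theorem IsLead.coeff_eq (h : IsLead w D p G) {m : σ →₀ ℕ} (hm : Finsupp.weight w m = D) :
    coeff m p = coeff m G := by
  by_contra hne
  have : m ∈ (p - G).support := by
    rw [mem_support_iff, coeff_sub]
    exact sub_ne_zero.2 hne
  exact (h.2 m this).ne hm

theorem IsLead.exists_mem_support (h : IsLead w D p G) (hG : G ≠ 0) :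
    ∃ m ∈ p.support, m ∈ G.support ∧ Finsupp.weight w m = D := by
  obtain ⟨m, hm⟩ := support_nonempty.2 hG
  refine ⟨m, ?_, hm, h.1 m hm⟩
  rw [mem_support_iff, h.coeff_eq (h.1 m hm)]
  exact mem_support_iff.1 hm

theorem IsLead.ne_zero (h : IsLead w D p G) (hG : G ≠ 0) : p ≠ 0 := by
  obtain ⟨m, hm, -⟩ := h.exists_mem_support hG
  exact support_nonempty.1 ⟨m, hm⟩

/-- The part of `p` of the largest allowed weight. -/
theorem WeightIn.exists_isLead (h : WeightIn w (Set.Iic D) p) :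
    ∃ G, IsLead w D p G ∧ ∀ m ∈ G.support, m ∈ p.support := by
  classical
  refine ⟨∑ m ∈ p.support with Finsupp.weight w m = D, monomial m (coeff m p), ?_, ?_⟩
  · refine ⟨WeightIn.sum fun m hm => weightIn_monomial _ (Finset.mem_filter.1 hm).2, ?_⟩
    conv => arg 3; arg 1; rw [p.as_sum]
    rw [← Finset.sum_filter_add_sum_filter_not p.support (fun m => Finsupp.weight w m = D),
      add_sub_cancel_left]
    refine WeightIn.sum fun m hm => weightIn_monomial _ ?_
    rw [Finset.mem_filter] at hm
    exact lt_of_le_of_ne (h m hm.1) hm.2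
  · intro m hm
    obtain ⟨m', hm', hmem⟩ := Finset.mem_biUnion.1 (support_sum hm)
    have := support_monomial_subset hmem
    rw [Finset.mem_singleton] at this
    subst this
    exact (Finset.mem_filter.1 hm').1

/-- If distinct monomials of `p` have distinct weights, the leading part is a monomial. -/
theorem exists_isLead_monomial (w : σ → ℝ) (hp : p ≠ 0)
    (hinj : Set.InjOn (Finsupp.weight w) (p.support : Set (σ →₀ ℕ))) :
    ∃ m ∈ p.support, (∀ m' ∈ p.support, Finsupp.weight w m' ≤ Finsupp.weight w m) ∧
      IsLead w (Finsupp.weight w m) p (monomial m (coeff m p)) := by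
  classical
  obtain ⟨m, hm, hmax⟩ := p.support.exists_max_image (Finsupp.weight w) (support_nonempty.2 hp)
  refine ⟨m, hm, hmax, weightIn_monomial _ rfl, ?_⟩
  intro m' hm'
  have hne : m' ≠ m := by
    rintro rfl
    rw [mem_support_iff, coeff_sub, coeff_monomial, if_pos rfl, sub_self] at hm'
    exact hm' rfl
  have hm'' : m' ∈ p.support := by
    rw [mem_support_iff, coeff_sub, coeff_monomial, if_neg hne.symm, sub_zero] at hm'
    exact mem_support_iff.2 hm'
  exact lt_of_le_of_ne (hmax m' hm'') fun h => hne (hinj hm'' hm h)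

end MvPolynomial

/-! ### Dynamical degrees from weighted degrees -/

open MvPolynomial

namespace PolyEnd

variable {k : Type*} [Field k] {n : ℕ}

theorem coord_mul (f g : PolyEnd k n) (i : Fin n) :
    (f * g).coord i = bind₁ g.coord (f.coord i) := rfl

theorem coord_one (i : Fin n) : (1 : PolyEnd k n).coord i = X i := rfl

theorem tendsto_const_rpow_inv {c : ℝ} (hc : 0 < c) :
    Filter.Tendsto (fun r : ℕ => c ^ (1 / (r : ℝ))) Filter.atTop (nhds 1) := by
  have h := tendsto_const_div_atTop_nhds_zero_nat (1 : ℝ)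
  simpa [Function.comp_def] using (Real.continuous_const_rpow hc.ne').tendsto 0 |>.comp h

theorem dynamicalDegree_le_of_degree_le (hn : 0 < n) {f : PolyEnd k n} (hf : IsUnit f)
    {c θ : ℝ} (hc : 0 < c) (hθ : 0 ≤ θ) (h : ∀ r, ((f ^ r).degree : ℝ) ≤ c * θ ^ r) :
    f.dynamicalDegree ≤ θ := by
  have h1 := (tendsto_const_rpow_inv hc).mul_const θ
  rw [one_mul] at h1
  refine le_of_tendsto_of_tendsto (tendsto_dynamicalDegree hn hf) h1 ?_
  filter_upwards [Filter.eventually_ge_atTop 1] with r hr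
  have hr' : (r : ℝ) ≠ 0 := by positivity
  calc ((f ^ r).degree : ℝ) ^ (1 / (r : ℝ)) ≤ (c * θ ^ r) ^ (1 / (r : ℝ)) :=
        Real.rpow_le_rpow (Nat.cast_nonneg _) (h r) (by positivity)
    _ = c ^ (1 / (r : ℝ)) * θ := by
        rw [Real.mul_rpow hc.le (by positivity), one_div, Real.pow_rpow_inv_natCast hθ (by omega)]

theorem le_dynamicalDegree_of_le_degree (hn : 0 < n) {f : PolyEnd k n} (hf : IsUnit f)
    {c θ : ℝ} (hc : 0 < c) (hθ : 0 ≤ θ) (h : ∀ r, c * θ ^ r ≤ ((f ^ r).degree : ℝ)) :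
    θ ≤ f.dynamicalDegree := by
  have h1 := (tendsto_const_rpow_inv hc).mul_const θ
  rw [one_mul] at h1
  refine le_of_tendsto_of_tendsto h1 (tendsto_dynamicalDegree hn hf) ?_
  filter_upwards [Filter.eventually_ge_atTop 1] with r hr
  calc c ^ (1 / (r : ℝ)) * θ = (c * θ ^ r) ^ (1 / (r : ℝ)) := by
        rw [Real.mul_rpow hc.le (by positivity), one_div, Real.pow_rpow_inv_natCast hθ (by omega)]
    _ ≤ ((f ^ r).degree : ℝ) ^ (1 / (r : ℝ)) :=
        Real.rpow_le_rpow (by positivity) (h r) (by positivity)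

theorem one_le_dynamicalDegree (hn : 0 < n) {f : PolyEnd k n} (hf : IsUnit f) :
    1 ≤ f.dynamicalDegree := by
  refine le_dynamicalDegree_of_le_degree hn hf one_pos zero_le_one fun r => ?_
  rw [one_pow, one_mul]
  exact_mod_cast one_le_degree hn (hf.pow r)

/-- Conjugation changes the degree of every iterate by at most the constant factor `h.degree *
h'.degree`, whose `r`-th root tends to `1`. -/
theorem dynamicalDegree_le_of_conj (hn : 0 < n) {f g h h' : PolyEnd k n} (hf : IsUnit f)
    (hg : IsUnit g) (hh : h * h' = 1) (hh' : h' * h = 1) (hgf : g = h * f * h') :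
    g.dynamicalDegree ≤ f.dynamicalDegree := by
  have hpow : ∀ r, g ^ r = h * f ^ r * h' := by
    intro r
    induction r with
    | zero => simp [hh]
    | succ r ih =>
      rw [pow_succ, ih, hgf, pow_succ]
      calc h * f ^ r * h' * (h * f * h') = h * f ^ r * (h' * h) * f * h' := by
            simp only [mul_assoc]
        _ = _ := by rw [hh']; simp only [mul_assoc, mul_one]
  have hdeg : ∀ r, (g ^ r).degree ≤ h.degree * h'.degree * (f ^ r).degree := by
    intro r
    rw [hpow, mul_right_comm]
    exact (degree_mul_le _ _).trans (Nat.mul_le_mul_right _ (degree_mul_le _ _))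
  have hc : (0 : ℝ) < h.degree * h'.degree := by
    have h1 : 1 ≤ h.degree := one_le_degree hn ⟨⟨h, h', hh, hh'⟩, rfl⟩
    have h2 : 1 ≤ h'.degree := one_le_degree hn ⟨⟨h', h, hh', hh⟩, rfl⟩
    exact_mod_cast Nat.mul_pos h1 h2
  have h1 := (tendsto_const_rpow_inv hc).mul (tendsto_dynamicalDegree hn hf)
  rw [one_mul] at h1
  refine le_of_tendsto_of_tendsto' (tendsto_dynamicalDegree hn hg) h1 fun r => ?_
  rw [← Real.mul_rpow hc.le (Nat.cast_nonneg _)]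
  exact Real.rpow_le_rpow (Nat.cast_nonneg _) (by exact_mod_cast hdeg r) (by positivity)

theorem dynamicalDegree_eq_of_conj (hn : 0 < n) {f g h h' : PolyEnd k n} (hf : IsUnit f)
    (hh : h * h' = 1) (hh' : h' * h = 1) (hgf : g = h * f * h') :
    IsUnit g ∧ g.dynamicalDegree = f.dynamicalDegree := by
  have hg : IsUnit g := by
    rw [hgf]
    exact (IsUnit.mul ⟨⟨h, h', hh, hh'⟩, rfl⟩ hf).mul ⟨⟨h', h, hh', hh⟩, rfl⟩
  refine ⟨hg, le_antisymm (dynamicalDegree_le_of_conj hn hf hg hh hh' hgf)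
    (dynamicalDegree_le_of_conj hn hg hf hh' hh ?_)⟩
  rw [hgf]
  calc f = (h' * h) * f * (h' * h) := by rw [hh']; simp
    _ = _ := by simp only [mul_assoc]

/-- A bound for the dynamical degree by the growth of a weighted degree. -/
theorem dynamicalDegree_le_of_weightIn (hn : 0 < n) {f : PolyEnd k n} (hf : IsUnit f)
    {w : Fin n → ℝ} {θ : ℝ} (hw : ∀ i, 0 < w i) (hθ : 0 < θ)
    (h : ∀ i, WeightIn w (Set.Iic (θ * w i)) (f.coord i)) : f.dynamicalDegree ≤ θ := by
  have hiter : ∀ r i, WeightIn w (Set.Iic (θ ^ r * w i)) ((f ^ r).coord i) := by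
    intro r
    induction r with
    | zero =>
      intro i
      rw [pow_zero, pow_zero, one_mul]
      exact weightIn_X i (Set.mem_Iic.2 le_rfl)
    | succ r ih =>
      intro i
      rw [pow_succ' f, coord_mul, pow_succ, mul_assoc]
      exact ((h i).smul_weight (pow_pos hθ r)).bind₁ (isLowerSet_Iic _) ih
  have : Nonempty (Fin n) := ⟨⟨0, hn⟩⟩
  obtain ⟨i₀, hi₀⟩ := Finite.exists_min w
  obtain ⟨i₁, hi₁⟩ := Finite.exists_max w
  -- A monomial of total degree `e` has weight at least `e` times the smallest weight, so the ratio
  -- of the extreme weights is a valid constant.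
  refine dynamicalDegree_le_of_degree_le hn hf (div_pos (hw i₁) (hw i₀)) hθ.le fun r => ?_
  rw [div_mul_eq_mul_div, le_div_iff₀ (hw i₀)]
  obtain ⟨i, -, hi⟩ := Finset.exists_mem_eq_sup (Finset.univ : Finset (Fin n))
    Finset.univ_nonempty fun i => ((f ^ r).coord i).totalDegree
  rw [degree, hi]
  rcases eq_or_ne ((f ^ r).coord i) 0 with h0 | h0
  · rw [h0, totalDegree_zero, Nat.cast_zero, zero_mul]
    exact mul_nonneg (hw i₁).le (pow_pos hθ r).le
  obtain ⟨m, hm, hmd⟩ := Finset.exists_mem_eq_sup _ (support_nonempty.2 h0)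
    fun m => m.sum fun _ e => e
  rw [totalDegree, hmd]
  calc ((m.sum fun _ e => e : ℕ) : ℝ) * w i₀ ≤ Finsupp.weight w m := by
        rw [Finsupp.weight_apply, Finsupp.sum, Finsupp.sum, Nat.cast_sum, Finset.sum_mul]
        refine Finset.sum_le_sum fun j _ => ?_
        rw [nsmul_eq_mul]
        exact mul_le_mul_of_nonneg_left (hi₀ j) (Nat.cast_nonneg _)
    _ ≤ θ ^ r * w i := hiter r i m hm
    _ ≤ w i₁ * θ ^ r := by
        rw [mul_comm]
        exact mul_le_mul_of_nonneg_right (hi₁ i) (pow_pos hθ r).le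

/-- A lower bound for the dynamical degree, by iteration of the leading part `g` of `f`. -/
theorem le_dynamicalDegree_of_isLead (hn : 0 < n) {f g : PolyEnd k n} (hf : IsUnit f)
    {w : Fin n → ℝ} {θ : ℝ} (hθ : 0 < θ)
    (h : ∀ i, IsLead w (θ * w i) (f.coord i) (g.coord i)) {i : Fin n} (hi : 0 < w i)
    (hg : ∀ r, (g ^ r).coord i ≠ 0) : θ ≤ f.dynamicalDegree := by
  have hiter : ∀ r i, IsLead w (θ ^ r * w i) ((f ^ r).coord i) ((g ^ r).coord i) := by
    intro r
    induction r with
    | zero =>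
      intro i
      rw [pow_zero, pow_zero, pow_zero, one_mul]
      exact isLead_X i
    | succ r ih =>
      intro i
      rw [pow_succ' f, pow_succ' g, coord_mul, coord_mul, pow_succ, mul_assoc]
      exact ((h i).smul_weight (pow_pos hθ r)).bind₁ ih
  have : Nonempty (Fin n) := ⟨⟨0, hn⟩⟩
  obtain ⟨i₁, hi₁⟩ := Finite.exists_max w
  have hpos : 0 < w i₁ := hi.trans_le (hi₁ i)
  -- Only the largest weight enters, so the other variables may have weight `0`; this is needed in
  -- `dynamicalDegree_eq_of_affine`.
  refine le_dynamicalDegree_of_le_degree hn hf (div_pos hi hpos) hθ.le fun r => ?_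
  rw [div_mul_eq_mul_div, div_le_iff₀ hpos]
  obtain ⟨m, hm, -, hmw⟩ := (hiter r i).exists_mem_support (hg r)
  calc w i * θ ^ r = Finsupp.weight w m := by rw [hmw, mul_comm]
    _ ≤ ((m.sum fun _ e => e : ℕ) : ℝ) * w i₁ := by
        rw [Finsupp.weight_apply, Finsupp.sum, Finsupp.sum, Nat.cast_sum, Finset.sum_mul]
        refine Finset.sum_le_sum fun j _ => ?_
        rw [nsmul_eq_mul]
        exact mul_le_mul_of_nonneg_left (hi₁ j) (Nat.cast_nonneg _)
    _ ≤ (f ^ r).degree * w i₁ := by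
        refine mul_le_mul_of_nonneg_right ?_ hpos.le
        exact_mod_cast (le_totalDegree hm).trans (totalDegree_coord_le (f ^ r) i)

theorem coord_pow_ne_zero_of_eq_pow {g : PolyEnd k n} {i : Fin n} {a : k} (ha : a ≠ 0) {m : ℕ}
    (h : g.coord i = C a * X i ^ m) (r : ℕ) : (g ^ r).coord i ≠ 0 := by
  induction r with
  | zero =>
    rw [pow_zero, coord_one]
    exact X_ne_zero i
  | succ r ih =>
    rw [pow_succ', coord_mul, h, map_mul, map_pow, bind₁_X_right, bind₁_C_right]
    exact mul_ne_zero (C_ne_zero.2 ha) (pow_ne_zero m ih)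

theorem weight_fin_three (w : Fin 3 → ℝ) (m : Fin 3 →₀ ℕ) :
    Finsupp.weight w m = m 0 * w 0 + m 1 * w 1 + m 2 * w 2 := by
  rw [Finsupp.weight_apply, Finsupp.sum_fintype _ _ (by simp)]
  simp [Fin.sum_univ_three]

/-- The weight `(0, 0, 1)` is the degree in the last variable, so this is an instance of
`WeightIn.bind₁`. -/
theorem apply_two_eq_zero_of_bind₁ {P : MvPolynomial (Fin 3) k}
    {f : Fin 3 → MvPolynomial (Fin 3) k} (hP : ∀ m ∈ P.support, m 2 = 0)
    (h0 : ∀ m ∈ (f 0).support, m 2 = 0) (h1 : ∀ m ∈ (f 1).support, m 2 = 0)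
    (h2 : ∀ m ∈ (f 2).support, m 2 ≤ 1) : ∀ m ∈ (bind₁ f P).support, m 2 = 0 := by
  have hw : ∀ (p : MvPolynomial (Fin 3) k) (d : ℕ), (∀ m ∈ p.support, m 2 ≤ d) ↔
      WeightIn ![0, 0, 1] (Set.Iic (d : ℝ)) p := by
    intro p d
    refine forall₂_congr fun m _ => ?_
    rw [weight_fin_three]
    simp
  have hle : ∀ {p : MvPolynomial (Fin 3) k}, (∀ m ∈ p.support, m 2 = 0) →
      ∀ m ∈ p.support, m 2 ≤ 0 := fun h m hm => (h m hm).le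
  have := WeightIn.bind₁ (f := f) ((hw P 0).1 (hle hP)) (isLowerSet_Iic _) (w := ![0, 0, 1])
    fun i => by
      fin_cases i
      · simpa using (hw _ 0).1 (hle h0)
      · simpa using (hw _ 0).1 (hle h1)
      · simpa using (hw _ 1).1 h2
  exact fun m hm => Nat.le_zero.1 ((hw _ 0).2 this m hm)

/-- If the first two coordinates have leading monomials of independent weights, then the
iterates do not vanish. -/
theorem coord_zero_pow_ne_zero {g : PolyEnd k 3} (hg2 : g.coord 2 = 0)
    (hg : ∀ i, ∀ m ∈ (g.coord i).support, m 2 = 0) {v : Fin 3 → ℝ} {W₀ W₁ : ℝ}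
    {m₀ m₁ : Fin 3 →₀ ℕ} {a₀ a₁ : k} (ha₀ : a₀ ≠ 0) (ha₁ : a₁ ≠ 0)
    (h₀ : IsLead v W₀ (g.coord 0) (monomial m₀ a₀))
    (h₁ : IsLead v W₁ (g.coord 1) (monomial m₁ a₁))
    (hW : ∀ i j i' j' : ℕ, i * W₀ + j * W₁ = i' * W₀ + j' * W₁ → i = i' ∧ j = j') (r : ℕ) :
    (g ^ r).coord 0 ≠ 0 := by
  suffices h : (g ^ r).coord 0 ≠ 0 ∧ ∀ m ∈ ((g ^ r).coord 0).support, m 2 = 0 from h.1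
  induction r with
  | zero =>
    rw [pow_zero, coord_one]
    refine ⟨X_ne_zero 0, fun m hm => ?_⟩
    rw [support_X, Finset.mem_singleton] at hm
    subst hm
    simp
  | succ r ih =>
    rw [pow_succ, coord_mul]
    generalize (g ^ r).coord 0 = P at ih
    obtain ⟨hP, hP2⟩ := ih
    constructor
    -- Weight the variables of `P` by the weights of what is substituted for them. By independence
    -- one monomial of `P` dominates, and its image, a product of nonzero monomials, cannot be
    -- cancelled.
    · obtain ⟨m, hm, -, hlead⟩ := exists_isLead_monomial ![W₀, W₁, 0] hP (by
        intro a ha b hb hab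
        rw [weight_fin_three, weight_fin_three] at hab
        simp only [Matrix.cons_val_zero, Matrix.cons_val_one, Matrix.cons_val, mul_zero,
          add_zero] at hab
        obtain ⟨h0, h1⟩ := hW _ _ _ _ hab
        ext i
        fin_cases i
        · exact h0
        · exact h1
        · exact (hP2 a ha).trans (hP2 b hb).symm)
      have hb := hlead.bind₁ (w := v) (f := g.coord)
        (g := ![monomial m₀ a₀, monomial m₁ a₁, 0]) (by
          intro i
          fin_cases i
          · exact h₀
          · exact h₁
          · change IsLead v 0 (g.coord 2) 0
            rw [hg2]
            exact weightIn_zero.isLead_self)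
      refine hb.ne_zero ?_
      rw [bind₁_monomial]
      refine mul_ne_zero (C_ne_zero.2 (mem_support_iff.1 hm))
        (Finset.prod_ne_zero_iff.2 fun i hi => pow_ne_zero _ ?_)
      fin_cases i
      · simpa using ha₀
      · simpa using ha₁
      · exact absurd (hP2 m hm) (Finsupp.mem_support_iff.1 hi)
    · refine apply_two_eq_zero_of_bind₁ hP2 (hg 0) (hg 1) fun m hm => ?_
      rw [hg 2 m hm]
      exact zero_le_one

end PolyEnd

/-! ### The two model families -/

namespace MvPolynomial

variable {σ k : Type*} [Field k] {w : σ → ℝ} {D : ℝ} {y G : MvPolynomial σ k}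

theorem WeightIn.aeval (hy : WeightIn w (Set.Iic D) y) (hD : 0 ≤ D) (p : Polynomial k) :
    WeightIn w (Set.Iic (p.natDegree * D)) (Polynomial.aeval y p) := by
  rw [Polynomial.aeval_eq_sum_range]
  refine WeightIn.sum fun i hi => ?_
  rw [smul_eq_C_mul]
  refine ((hy.pow_Iic i).C_mul _).mono (Set.Iic_subset_Iic.2 ?_)
  refine mul_le_mul_of_nonneg_right ?_ hD
  exact_mod_cast Nat.lt_succ_iff.1 (Finset.mem_range.1 hi)

theorem IsLead.aeval (hy : IsLead w D y G) (hD : 0 < D) (p : Polynomial k) :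
    IsLead w (p.natDegree * D) (Polynomial.aeval y p) (C p.leadingCoeff * G ^ p.natDegree) := by
  rw [Polynomial.aeval_eq_sum_range, Finset.sum_range_succ, add_comm]
  refine IsLead.add_lt ?_ (WeightIn.sum fun i hi => ?_)
  · rw [smul_eq_C_mul]
    simpa using (isLead_C p.leadingCoeff).mul (hy.pow p.natDegree)
  · rw [smul_eq_C_mul]
    refine ((hy.weightIn.pow_Iic i).C_mul _).mono (Set.Iic_subset_Iio.2 ?_)
    refine mul_lt_mul_of_pos_right ?_ hD
    exact_mod_cast Finset.mem_range.1 hi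

theorem bind₁_aeval {τ : Type*} (f : σ → MvPolynomial τ k) (y : MvPolynomial σ k)
    (p : Polynomial k) :
    bind₁ f (Polynomial.aeval y p) = Polynomial.aeval (bind₁ f y) p :=
  (Polynomial.aeval_algHom_apply (bind₁ f) y p).symm

end MvPolynomial

/-- Hence the weights `1` and `x` separate the monomials in two variables. -/
theorem Irrational.add_mul_natCast_inj {x : ℝ} (hx : Irrational x) {a b a' b' : ℕ}
    (h : (a : ℝ) + b * x = a' + b' * x) : a = a' ∧ b = b' := by
  by_cases hb : b = b'
  · subst hb
    exact ⟨by exact_mod_cast add_right_cancel h, rfl⟩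
  · exfalso
    have hb' : ((b : ℝ) - b') ≠ 0 := sub_ne_zero.2 (by exact_mod_cast hb)
    refine hx ⟨((a' : ℚ) - a) / (b - b'), ?_⟩
    push_cast
    rw [div_eq_iff hb']
    linarith

namespace PolyEnd

variable {k : Type*} [Field k]

theorem monomial_eq_C_mul_pow {m : Fin 3 →₀ ℕ} (h1 : m 1 = 0) (h2 : m 2 = 0) (a : k) :
    monomial m a = C a * X 0 ^ m 0 := by
  have hm : m = Finsupp.single 0 (m 0) := by
    ext i
    fin_cases i <;> simp [h1, h2]
  rw [C_mul_X_pow_eq_monomial, ← hm]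

theorem weightIn_C_mul_X {w : Fin 3 → ℝ} {S : Set ℝ} (a : k) (i : Fin 3) (h : w i ∈ S) :
    WeightIn w S (C a * X i) := (weightIn_X i h).C_mul a

/-- The dynamical degree when the second coordinate involves the first variable. -/
theorem dynamicalDegree_eq_of_natDegree_pos {f : PolyEnd k 3} (hf : IsUnit f) {e η : k}
    {Q : MvPolynomial (Fin 3) k} {p : Polynomial k} (h0 : f.coord 0 = C e * X 2 + Q)
    (hQ : ∀ m ∈ Q.support, m 2 = 0) (h1 : f.coord 1 = C η * X 1 + Polynomial.aeval (X 0) p)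
    (hp : 1 ≤ p.natDegree)
    (h2 : (∃ a b, f.coord 2 = C a * X 0 + C b) ∨
      p.natDegree = 1 ∧ ∃ a b, f.coord 2 = C a * X 1 + C b)
    {θ : ℝ} (hθ : 1 ≤ θ) (hle : ∀ m ∈ Q.support, m 0 * θ + m 1 * p.natDegree ≤ θ ^ 2)
    (heq : θ = 1 ∨ ∃ m ∈ Q.support, m 0 * θ + m 1 * p.natDegree = θ ^ 2) :
    f.dynamicalDegree = θ := by
  have hc : (1 : ℝ) ≤ p.natDegree := by exact_mod_cast hp
  set c : ℝ := (p.natDegree : ℝ) with hcdef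
  -- These weights make `θ` an eigenvalue: `p(x₁)` has weight `c * θ`, and `Q` has weight at most `θ
  -- ^ 2` by the choice of `θ`. The third coordinate has weight at most `θ`; in its second form this
  -- uses `c = 1`.
  set w : Fin 3 → ℝ := ![θ, c, θ] with hw
  have w0 : w 0 = θ := rfl
  have w1 : w 1 = c := rfl
  have w2 : w 2 = θ := rfl
  have hQw : WeightIn w (Set.Iic (θ ^ 2)) Q := by
    intro m hm
    rw [weight_fin_three, w0, w1, w2, hQ m hm, Nat.cast_zero, zero_mul, add_zero]
    exact hle m hm
  have hX0 : IsLead w θ (X 0 : MvPolynomial (Fin 3) k) (X 0) := isLead_X 0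
  have hp' := hX0.aeval (by linarith) p
  have h2w : WeightIn w (Set.Iic θ) (f.coord 2) := by
    rcases h2 with ⟨a, b, h⟩ | ⟨h, a, b, h'⟩
    · rw [h]
      exact (weightIn_C_mul_X a 0 (Set.mem_Iic.2 (by rw [w0]))).add
        (weightIn_C b (Set.mem_Iic.2 (by linarith)))
    · rw [h']
      refine (weightIn_C_mul_X a 1 (Set.mem_Iic.2 ?_)).add
        (weightIn_C b (Set.mem_Iic.2 (by linarith)))
      rw [w1, hcdef, h, Nat.cast_one]
      exact hθ
  apply le_antisymm
  · refine dynamicalDegree_le_of_weightIn (w := w) (by norm_num) hf ?_ (by linarith) ?_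
    · intro i
      fin_cases i
      · change 0 < w 0; linarith
      · change 0 < w 1; linarith
      · change 0 < w 2; linarith
    · intro i
      fin_cases i
      · change WeightIn w (Set.Iic (θ * w 0)) (f.coord 0)
        rw [h0, w0, ← pow_two]
        refine (weightIn_C_mul_X e 2 (Set.mem_Iic.2 ?_)).add hQw
        rw [w2]
        nlinarith
      · change WeightIn w (Set.Iic (θ * w 1)) (f.coord 1)
        rw [h1, w1, mul_comm]
        refine (weightIn_C_mul_X η 1 (Set.mem_Iic.2 ?_)).add hp'.weightIn
        rw [w1]
        nlinarith
      · change WeightIn w (Set.Iic (θ * w 2)) (f.coord 2)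
        rw [w2]
        exact h2w.mono (Set.Iic_subset_Iic.2 (by nlinarith))
  rcases hθ.eq_or_lt with h | hθ1
  · rw [← h]
    exact one_le_dynamicalDegree (by norm_num) hf
  obtain ⟨m, hm, hmθ⟩ := heq.resolve_left hθ1.ne'
  obtain ⟨G, hG, hGQ⟩ := hQw.exists_isLead
  have hmw : Finsupp.weight w m = θ ^ 2 := by
    rw [weight_fin_three, w0, w1, w2, hQ m hm, Nat.cast_zero, zero_mul, add_zero, hmθ]
  have hGm : m ∈ G.support := by
    rw [mem_support_iff, ← hG.coeff_eq hmw]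
    exact mem_support_iff.1 hm
  have hs : p.leadingCoeff ≠ 0 := by
    rw [Polynomial.leadingCoeff_ne_zero]
    rintro rfl
    simp at hp
  -- Since `θ > 1`, the terms `e x₃`, `η x₂` and the whole third coordinate have too small a weight
  -- to contribute.
  let g : PolyEnd k 3 := ⟨![G, C p.leadingCoeff * X 0 ^ p.natDegree, 0]⟩
  refine le_dynamicalDegree_of_isLead (w := w) (g := g) (i := 0) (by norm_num) hf (by linarith)
    ?_ (by linarith) ?_
  · intro i
    fin_cases i
    · change IsLead w (θ * w 0) (f.coord 0) G
      rw [h0, w0, ← pow_two, add_comm]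
      refine hG.add_lt (weightIn_C_mul_X e 2 (Set.mem_Iio.2 ?_))
      rw [w2]
      nlinarith
    · change IsLead w (θ * w 1) (f.coord 1) (C p.leadingCoeff * X 0 ^ p.natDegree)
      rw [h1, w1, mul_comm θ, add_comm]
      refine hp'.add_lt (weightIn_C_mul_X η 1 (Set.mem_Iio.2 ?_))
      rw [w1]
      nlinarith
    · change IsLead w (θ * w 2) (f.coord 2) 0
      rw [w2]
      exact (h2w.mono (Set.Iic_subset_Iio.2 (by nlinarith))).isLead_zero
  -- If `G` involves only `x₁`, homogeneity makes it a single power of `x₁` up to a scalar, and its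
  -- iterates remain nonzero. This case is separate because the weights of `g₁` and `g₂` would then
  -- be dependent.
  by_cases hG1 : ∀ m ∈ G.support, m 1 = 0
  · have huniq : ∀ m' ∈ G.support, m' = m := by
      intro m' hm'
      have e1 := hG.1 m' hm'
      rw [Set.mem_singleton_iff, weight_fin_three, w0, w1, w2, hQ m' (hGQ m' hm'), hG1 m' hm'] at e1
      rw [hG1 m hGm] at hmθ
      have e2 : (m' 0 : ℝ) = m 0 := by
        have : (m' 0 : ℝ) * θ = m 0 * θ := by
          simp only [Nat.cast_zero, zero_mul, add_zero] at e1 hmθ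
          rw [e1, hmθ]
        exact mul_right_cancel₀ (by linarith) this
      ext i
      fin_cases i
      · exact_mod_cast e2
      · exact (hG1 m' hm').trans (hG1 m hGm).symm
      · exact (hQ m' (hGQ m' hm')).trans (hQ m hm).symm
    have hGmon : G = C (coeff m G) * X 0 ^ m 0 := by
      rw [← monomial_eq_C_mul_pow (hG1 m hGm) (hQ m hm)]
      have : G.support = {m} := by
        ext m'
        rw [Finset.mem_singleton]
        exact ⟨huniq m', fun h => h ▸ hGm⟩
      conv_lhs => rw [G.as_sum, this, Finset.sum_singleton]
    exact coord_pow_ne_zero_of_eq_pow (g := g) (mem_support_iff.1 hGm) hGmon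
  · push Not at hG1
    obtain ⟨m₁, hm₁, hm₁1⟩ := hG1
    have hirr : Irrational (√2 + G.totalDegree) := irrational_sqrt_two.add_natCast _
    -- Irrationality separates the monomials of `G`. Exceeding the total degree forces the leading
    -- one to contain `x₂`, so its weight is independent of the integer weight of `x₁ ^ c`.
    set N : ℝ := √2 + G.totalDegree with hN
    have hNpos : (G.totalDegree : ℝ) < N := by
      rw [hN]
      have : 0 < √(2 : ℝ) := by positivity
      linarith
    have hv : ∀ m ∈ G.support, Finsupp.weight ![1, N, 0] m = m 0 + m 1 * N := by
      intro m _
      rw [weight_fin_three]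
      simp
    obtain ⟨M, hM, hmax, hlead⟩ := exists_isLead_monomial ![1, N, 0]
      (support_nonempty.1 ⟨m, hGm⟩) (by
        intro a ha b hb hab
        rw [hv a ha, hv b hb] at hab
        obtain ⟨h0, h1⟩ := hirr.add_mul_natCast_inj hab
        ext i
        fin_cases i
        · exact h0
        · exact h1
        · exact (hQ a (hGQ a ha)).trans (hQ b (hGQ b hb)).symm)
    have hM1 : M 1 ≠ 0 := by
      intro h
      have e1 := hmax m₁ hm₁
      rw [hv M hM, hv m₁ hm₁, h, Nat.cast_zero, zero_mul, add_zero] at e1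
      have e2 : (M 0 : ℝ) ≤ G.totalDegree := by
        refine Nat.cast_le.2 (le_trans ?_ (le_totalDegree hM))
        rw [Finsupp.sum_fintype _ _ (by simp), Fin.sum_univ_three]
        omega
      have e3 : (1 : ℝ) ≤ m₁ 1 := by exact_mod_cast Nat.one_le_iff_ne_zero.2 hm₁1
      have e4 : (0 : ℝ) ≤ m₁ 0 := Nat.cast_nonneg _
      have e5 : (0 : ℝ) ≤ G.totalDegree := Nat.cast_nonneg _
      nlinarith
    have hlead1 : IsLead ![1, N, 0] c (C p.leadingCoeff * X 0 ^ p.natDegree)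
        (monomial (Finsupp.single 0 p.natDegree) p.leadingCoeff) := by
      rw [C_mul_X_pow_eq_monomial]
      have := isLead_monomial (w := ![1, N, 0]) (Finsupp.single (0 : Fin 3) p.natDegree)
        p.leadingCoeff
      rw [weight_fin_three] at this
      simpa using this
    refine coord_zero_pow_ne_zero (g := g) rfl ?_ (mem_support_iff.1 hM) hs hlead hlead1 ?_
    · intro i m' hm'
      fin_cases i
      · exact hQ m' (hGQ m' hm')
      · change m' ∈ (C p.leadingCoeff * X 0 ^ p.natDegree : MvPolynomial (Fin 3) k).support at hm'
        rw [C_mul_X_pow_eq_monomial] at hm'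
        have := support_monomial_subset hm'
        rw [Finset.mem_singleton] at this
        subst this
        simp
      · exact absurd hm' (by simp [g])
    · intro i j i' j' h
      rw [hv M hM] at h
      have h' : ((i * M 0 + j * p.natDegree : ℕ) : ℝ) + ((i * M 1 : ℕ) : ℝ) * N =
          ((i' * M 0 + j' * p.natDegree : ℕ) : ℝ) + ((i' * M 1 : ℕ) : ℝ) * N := by
        push_cast
        linarith
      obtain ⟨e1, e2⟩ := hirr.add_mul_natCast_inj h'
      have e3 : i = i' := Nat.eq_of_mul_eq_mul_right (Nat.pos_of_ne_zero hM1) e2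
      subst e3
      refine ⟨rfl, Nat.eq_of_mul_eq_mul_right hp (Nat.add_left_cancel e1)⟩

/-- The dynamical degree when the second coordinate involves only the second variable. -/
theorem dynamicalDegree_eq_of_affine {f : PolyEnd k 3} (hf : IsUnit f) {e η ζ a : k} (hη : η ≠ 0)
    {Q : MvPolynomial (Fin 3) k} {p : Polynomial k} (h0 : f.coord 0 = C e * X 2 + Q)
    (hQ : ∀ m ∈ Q.support, m 2 = 0) (h1 : f.coord 1 = C η * X 1 + C ζ)
    (h2 : f.coord 2 = C a * X 0 + Polynomial.aeval (X 1) p)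
    {M : ℕ} (hM : 1 ≤ M) (hle : ∀ m ∈ Q.support, m 0 ≤ M)
    (heq : M = 1 ∨ ∃ m ∈ Q.support, m 0 = M) :
    f.dynamicalDegree = M := by
  have hM' : (1 : ℝ) ≤ M := by exact_mod_cast hM
  apply le_antisymm
  -- The natural weights `(1, 0, 1)` are not all positive, so `x₂` gets a small weight `δ`. The
  -- factor `K` bounds both the `x₂`-degree of `Q` and the degree of `p`, so the loss is at most `K
  -- * δ = ε`.
  · refine le_of_forall_pos_le_add fun ε hε => ?_
    set K : ℝ := Q.totalDegree + p.natDegree + 1 with hK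
    have hK1 : 0 < K := by positivity
    set δ : ℝ := ε / K with hδdef
    have hδ : 0 < δ := div_pos hε hK1
    have hδK : K * δ = ε := by rw [hδdef]; field_simp
    set w : Fin 3 → ℝ := ![1, δ, 1] with hw
    have w0 : w 0 = 1 := rfl
    have w1 : w 1 = δ := rfl
    have w2 : w 2 = 1 := rfl
    refine dynamicalDegree_le_of_weightIn (w := w) (by norm_num) hf ?_ (by linarith) ?_
    · intro i
      fin_cases i
      · change 0 < w 0; linarith
      · change 0 < w 1; linarith
      · change 0 < w 2; linarith
    · intro i
      fin_cases i
      · change WeightIn w (Set.Iic ((M + ε) * w 0)) (f.coord 0)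
        rw [h0, w0, mul_one]
        refine (weightIn_C_mul_X e 2 (Set.mem_Iic.2 ?_)).add ?_
        · rw [w2]
          linarith
        · intro m hm
          rw [weight_fin_three, w0, w1, w2, hQ m hm, Set.mem_Iic]
          have e1 : (m 0 : ℝ) ≤ M := by exact_mod_cast hle m hm
          have e2 : (m 1 : ℝ) ≤ Q.totalDegree := by
            refine Nat.cast_le.2 (le_trans ?_ (le_totalDegree hm))
            rw [Finsupp.sum_fintype _ _ (by simp), Fin.sum_univ_three]
            omega
          have e3 : (m 1 : ℝ) ≤ K := by
            rw [hK]
            have : (0 : ℝ) ≤ p.natDegree := Nat.cast_nonneg _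
            linarith
          have e4 := mul_le_mul_of_nonneg_right e3 hδ.le
          simp only [Nat.cast_zero, add_zero, mul_one]
          linarith
      · change WeightIn w (Set.Iic ((M + ε) * w 1)) (f.coord 1)
        rw [h1, w1]
        refine (weightIn_C_mul_X η 1 (Set.mem_Iic.2 ?_)).add
          (weightIn_C ζ (Set.mem_Iic.2 (by positivity)))
        rw [w1]
        nlinarith
      · change WeightIn w (Set.Iic ((M + ε) * w 2)) (f.coord 2)
        rw [h2, w2, mul_one]
        refine (weightIn_C_mul_X a 0 (Set.mem_Iic.2 ?_)).add ?_
        · rw [w0]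
          linarith
        · refine ((weightIn_X 1 (Set.mem_Iic.2 le_rfl)).aeval (by rw [w1]; exact hδ.le) p).mono
            (Set.Iic_subset_Iic.2 ?_)
          rw [w1]
          have : (p.natDegree : ℝ) ≤ K := by
            rw [hK]
            have : (0 : ℝ) ≤ Q.totalDegree := Nat.cast_nonneg _
            linarith
          have e4 := mul_le_mul_of_nonneg_right this hδ.le
          linarith
  rcases hM.eq_or_lt with h | hM1
  · rw [← h, Nat.cast_one]
    exact one_le_dynamicalDegree (by norm_num) hf
  have hM1' : (1 : ℝ) < M := by exact_mod_cast hM1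
  obtain ⟨m, hm, hmM⟩ := heq.resolve_left hM1.ne'
  -- For the lower bound weight `0` for `x₂` is allowed, and the affine second coordinate is then
  -- its own leading part.
  set w : Fin 3 → ℝ := ![1, 0, 1] with hw
  have w0 : w 0 = 1 := rfl
  have w1 : w 1 = 0 := rfl
  have w2 : w 2 = 1 := rfl
  have hwt : ∀ m ∈ Q.support, Finsupp.weight w m = m 0 := by
    intro m hm
    rw [weight_fin_three, w0, w1, w2, hQ m hm]
    simp
  have hQw : WeightIn w (Set.Iic (M : ℝ)) Q := by
    intro m hm
    rw [hwt m hm]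
    exact Set.mem_Iic.2 (Nat.cast_le.2 (hle m hm))
  obtain ⟨G, hG, hGQ⟩ := hQw.exists_isLead
  have hGm : m ∈ G.support := by
    rw [mem_support_iff, ← hG.coeff_eq (by rw [hwt m hm, hmM])]
    exact mem_support_iff.1 hm
  let g : PolyEnd k 3 := ⟨![G, C η * X 1 + C ζ, 0]⟩
  refine le_dynamicalDegree_of_isLead (w := w) (g := g) (i := 0) (by norm_num) hf (by linarith)
    ?_ (by linarith) ?_
  · intro i
    fin_cases i
    · change IsLead w (M * w 0) (f.coord 0) G
      rw [h0, w0, mul_one, add_comm]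
      refine hG.add_lt (weightIn_C_mul_X e 2 (Set.mem_Iio.2 ?_))
      rw [w2]
      exact hM1'
    · change IsLead w (M * w 1) (f.coord 1) (C η * X 1 + C ζ)
      rw [h1, w1, mul_zero]
      exact ((weightIn_C_mul_X η 1 (Set.mem_singleton_iff.2 w1)).add
        (weightIn_C ζ (Set.mem_singleton _))).isLead_self
    · change IsLead w (M * w 2) (f.coord 2) 0
      rw [h2, w2, mul_one]
      refine WeightIn.isLead_zero (WeightIn.mono (S := Set.Iic 1) ?_
        (Set.Iic_subset_Iio.2 hM1'))
      refine (weightIn_C_mul_X a 0 (Set.mem_Iic.2 (by rw [w0]))).add ?_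
      refine ((weightIn_X 1 (Set.mem_Iic.2 le_rfl)).aeval (by rw [w1]) p).mono
        (Set.Iic_subset_Iic.2 ?_)
      rw [w1, mul_zero]
      exact zero_le_one
  have hv : ∀ m ∈ G.support, Finsupp.weight ![√2, 1, 0] m = m 1 + m 0 * √2 := by
    intro m _
    rw [weight_fin_three]
    simp [add_comm]
  -- Every monomial of `G` has `x₁`-exponent `M > 0`, so its weight has a nonzero `√2` component and
  -- is independent of the weight `1` of `η x₂`.
  obtain ⟨N, hN, -, hlead⟩ := exists_isLead_monomial ![√2, 1, 0]
    (support_nonempty.1 ⟨m, hGm⟩) (by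
      intro a ha b hb hab
      rw [hv a ha, hv b hb] at hab
      obtain ⟨h1, h0⟩ := irrational_sqrt_two.add_mul_natCast_inj hab
      ext i
      fin_cases i
      · exact h0
      · exact h1
      · exact (hQ a (hGQ a ha)).trans (hQ b (hGQ b hb)).symm)
  have hN0 : N 0 = M := by
    have := hG.1 N hN
    rw [Set.mem_singleton_iff, hwt N (hGQ N hN)] at this
    exact_mod_cast this
  have hlead1 : IsLead ![√2, 1, 0] 1 (C η * X 1 + C ζ)
      (monomial (Finsupp.single (1 : Fin 3) 1) η) := by
    refine IsLead.add_lt ?_ (weightIn_C ζ (Set.mem_Iio.2 one_pos))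
    have := isLead_monomial (w := ![√2, 1, 0]) (Finsupp.single (1 : Fin 3) 1) η
    rw [weight_fin_three] at this
    simpa [C_mul_X_eq_monomial] using this
  refine coord_zero_pow_ne_zero (g := g) rfl ?_ (mem_support_iff.1 hN) hη hlead hlead1 ?_
  · intro i m' hm'
    fin_cases i
    · exact hQ m' (hGQ m' hm')
    · change m' ∈ (C η * X 1 + C ζ : MvPolynomial (Fin 3) k).support at hm'
      rcases Finset.mem_union.1 (support_add hm') with h | h
      · rw [C_mul_X_eq_monomial] at h
        have := support_monomial_subset h
        rw [Finset.mem_singleton] at this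
        subst this
        simp
      · have := support_monomial_subset h
        rw [Finset.mem_singleton] at this
        subst this
        simp
    · exact absurd hm' (by simp [g])
  · intro i j i' j' h
    rw [hv N hN] at h
    have h' : ((i * N 1 + j : ℕ) : ℝ) + ((i * N 0 : ℕ) : ℝ) * √2 =
        ((i' * N 1 + j' : ℕ) : ℝ) + ((i' * N 0 : ℕ) : ℝ) * √2 := by
      push_cast
      linarith
    obtain ⟨e1, e2⟩ := irrational_sqrt_two.add_mul_natCast_inj h'
    have e3 : i = i' := Nat.eq_of_mul_eq_mul_right (by omega) e2
    subst e3
    exact ⟨rfl, Nat.add_left_cancel e1⟩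

end PolyEnd

/-! ### Shape of triangular automorphisms -/

namespace MvPolynomial

variable {σ k : Type*} [Field k]

theorem bind₁_mem_of_forall_mem {τ : Type*} {f : σ → MvPolynomial τ k}
    {S : Subalgebra k (MvPolynomial τ k)} (h : ∀ i, f i ∈ S) (p : MvPolynomial σ k) :
    bind₁ f p ∈ S := by
  induction p using MvPolynomial.induction_on with
  | C a =>
    rw [bind₁_C_right]
    exact S.algebraMap_mem a
  | add p q hp hq =>
    rw [map_add]
    exact S.add_mem hp hq
  | mul_X p i hp =>
    rw [map_mul, bind₁_X_right]
    exact S.mul_mem hp (h i)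

theorem apply_eq_zero_of_mem_supported {s : Set σ} {p : MvPolynomial σ k} (hp : p ∈ supported k s)
    {m : σ →₀ ℕ} (hm : m ∈ p.support) {i : σ} (hi : i ∉ s) : m i = 0 := by
  by_contra h
  exact hi (mem_supported.1 hp ((mem_vars_iff_mem_support i).2 ⟨m, hm, Finsupp.mem_support_iff.2 h⟩))

section

variable [DecidableEq σ]

/-- View a polynomial as a polynomial in the variable `i`. -/
noncomputable def asPolynomial (i : σ) :
    MvPolynomial σ k →ₐ[k] Polynomial (MvPolynomial σ k) :=
  aeval (Function.update (fun l => Polynomial.C (X l)) i Polynomial.X)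

theorem asPolynomial_X_self (i : σ) :
    asPolynomial i (X i : MvPolynomial σ k) = Polynomial.X := by
  simp [asPolynomial]

theorem asPolynomial_of_mem {i : σ} {p : MvPolynomial σ k} (hp : p ∈ supported k {i}ᶜ) :
    asPolynomial i p = Polynomial.C p := by
  refine hom_congr_vars (f₁ := (asPolynomial (k := k) i).toRingHom)
    (f₂ := Polynomial.C) ?_ ?_ rfl
  · ext a : 1
    exact (asPolynomial (k := k) i).commutes a
  · intro l hl _
    have : l ≠ i := mem_supported.1 hp hl
    simp [asPolynomial, this]

theorem eval_asPolynomial (i : σ) (p y : MvPolynomial σ k) :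
    (asPolynomial i p).eval y = bind₁ (Function.update X i y) p := by
  have : ((Polynomial.aeval y).restrictScalars k).comp (asPolynomial i) =
      bind₁ (Function.update X i y) := by
    ext1 l
    rw [AlgHom.comp_apply, bind₁_X_right]
    rcases eq_or_ne l i with rfl | hl
    · simp [asPolynomial]
    · simp [asPolynomial, hl]
  exact DFunLike.congr_fun this p

/-- If the variables lie in the algebra generated by `t`, where only `t i` involves the
variable `i`, then `t i` is affine in this variable with constant slope, and it is not needed to
generate the other variables. -/
theorem exists_affine_of_bind₁_eq_X {t : σ → MvPolynomial σ k} {i : σ}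
    (ht : ∀ l ≠ i, t l ∈ supported k {i}ᶜ) {P : σ → MvPolynomial σ k}
    (hPi : bind₁ t (P i) = X i) :
    (∃ β : k, β ≠ 0 ∧ ∃ b ∈ supported k {i}ᶜ, t i = C β * X i + b) ∧
      ∀ j ≠ i, bind₁ t (P j) = X j → bind₁ (Function.update t i 0) (P j) = X j := by
  -- Here `t i` is replaced by a formal variable. Restoring `t i` is a composition of univariate
  -- polynomials, and degrees multiply under composition.
  let h : MvPolynomial σ k →ₐ[k] Polynomial (MvPolynomial σ k) :=
    aeval (Function.update (fun l => Polynomial.C (t l)) i Polynomial.X)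
  have hcomp : ∀ p, asPolynomial i (bind₁ t p) = (h p).comp (asPolynomial i (t i)) := by
    intro p
    have : (asPolynomial i).comp (bind₁ t) =
        ((Polynomial.aeval (asPolynomial i (t i))).restrictScalars k).comp h := by
      ext1 l
      rw [AlgHom.comp_apply, bind₁_X_right]
      rcases eq_or_ne l i with rfl | hl
      · simp [h]
      · rw [asPolynomial_of_mem (ht l hl)]
        simp [h, hl]
    exact DFunLike.congr_fun this p
  have hdeg := congrArg Polynomial.natDegree (hcomp (P i))
  rw [hPi, asPolynomial_X_self, Polynomial.natDegree_X, Polynomial.natDegree_comp] at hdeg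
  have hd1 : (asPolynomial i (t i)).natDegree = 1 := Nat.eq_one_of_mul_eq_one_left hdeg.symm
  refine ⟨?_, fun j hj hPj => ?_⟩
  · have hlc := congrArg Polynomial.leadingCoeff (hcomp (P i))
    rw [hPi, asPolynomial_X_self, Polynomial.leadingCoeff_X,
      Polynomial.leadingCoeff_comp (by omega), Nat.eq_one_of_mul_eq_one_right hdeg.symm,
      pow_one] at hlc
    have hunit : IsUnit (asPolynomial i (t i)).leadingCoeff := .of_mul_eq_one_right _ hlc.symm
    obtain ⟨β, hβ, hβ'⟩ := isUnit_iff_eq_C_of_isReduced.1 hunit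
    refine ⟨β, hβ.ne_zero, (asPolynomial i (t i)).coeff 0, ?_, ?_⟩
    · rw [Polynomial.coeff_zero_eq_eval_zero, eval_asPolynomial]
      refine bind₁_mem_of_forall_mem (fun l => ?_) _
      rcases eq_or_ne l i with rfl | hl
      · simp
      · simp [hl]
    · have h1 := eval_asPolynomial i (t i) (X i)
      rw [Function.update_eq_self, bind₁_X_left, AlgHom.id_apply] at h1
      rw [Polynomial.eval_eq_sum_range, hd1, Finset.sum_range_succ, Finset.sum_range_one,
        pow_zero, mul_one, pow_one, add_comm] at h1
      rw [← hβ', Polynomial.leadingCoeff, hd1, h1]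
  · have hdegj := congrArg Polynomial.natDegree (hcomp (P j))
    have hX : (X j : MvPolynomial σ k) ∈ supported k {i}ᶜ := X_mem_supported.2 hj
    rw [hPj, asPolynomial_of_mem hX, Polynomial.natDegree_C, Polynomial.natDegree_comp, hd1,
      mul_one] at hdegj
    -- As `t i` has degree `1` in the variable `i`, the polynomial `h (P j)` must be constant;
    -- evaluating it at `0` amounts to replacing `t i` by `0`.
    have hc := hcomp (P j)
    rw [hPj, asPolynomial_of_mem hX, Polynomial.eq_C_of_natDegree_eq_zero hdegj.symm,
      Polynomial.C_comp, Polynomial.C_inj, Polynomial.coeff_zero_eq_eval_zero] at hc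
    rw [hc]
    have : bind₁ (Function.update t i 0) =
        ((Polynomial.aeval (0 : MvPolynomial σ k)).restrictScalars k).comp h := by
      ext1 l
      rw [bind₁_X_right]
      rcases eq_or_ne l i with rfl | hl
      · simp [h]
      · simp [h, hl]
    rw [this]
    rfl

end

theorem exists_aeval_of_mem_supported_singleton {i : σ} {p : MvPolynomial σ k}
    (hp : p ∈ supported k {i}) : ∃ q : Polynomial k, p = Polynomial.aeval (X i) q := by
  rw [supported_eq_adjoin_X, Set.image_singleton, Algebra.adjoin_singleton_eq_range_aeval] at hp
  obtain ⟨q, rfl⟩ := hp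
  exact ⟨q, rfl⟩

end MvPolynomial

namespace PolyEnd

variable {k : Type*} [Field k] {n : ℕ}

theorem IsTriangular.mul {f g : PolyEnd k n} (hf : f.IsTriangular) (hg : g.IsTriangular) :
    (f * g).IsTriangular := by
  intro i
  rw [coord_mul, mem_supported]
  intro l hl
  obtain ⟨j, hj, hlj⟩ := Finset.mem_biUnion.1 (vars_bind₁ g.coord (f.coord i) hl)
  exact Set.mem_Iic.2 (le_trans (mem_supported.1 (hg j) hlj) (mem_supported.1 (hf i) hj))

/-- The shape of a triangular automorphism. -/
theorem IsTriangular.exists_eq {τ : PolyEnd k 3} (hτ : τ.IsTriangular) (hu : IsUnit τ) :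
    ∃ (a₀ a₁ a₂ b : k) (p : Polynomial k) (q : MvPolynomial (Fin 3) k),
      a₀ ≠ 0 ∧ a₁ ≠ 0 ∧ a₂ ≠ 0 ∧ (∀ m ∈ q.support, m 2 = 0) ∧
      τ.coord 0 = C a₀ * X 0 + C b ∧ τ.coord 1 = C a₁ * X 1 + Polynomial.aeval (X 0) p ∧
      τ.coord 2 = C a₂ * X 2 + q := by
  obtain ⟨u, rfl⟩ := hu
  set τ : PolyEnd k 3 := (u : PolyEnd k 3)
  set ρ : PolyEnd k 3 := (↑u⁻¹ : PolyEnd k 3)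
  have hρ : ∀ j, bind₁ τ.coord (ρ.coord j) = X j := fun j =>
    congrFun (congrArg PolyEnd.coord (Units.inv_mul u)) j
  have hmem : ∀ l i : Fin 3, l < i → τ.coord l ∈ supported k {i}ᶜ := fun l i hli =>
    supported_mono (fun j (hj : j ≤ l) => (hj.trans_lt hli).ne) (hτ l)
  -- Descending induction on the variable: once the last coordinate is understood it is set to `0`,
  -- and the remaining variables are still generated.
  obtain ⟨⟨a₂, ha₂, q, hq, h2⟩, hρ2⟩ := exists_affine_of_bind₁_eq_X (t := τ.coord) (i := 2)
    (fun l hl => hmem l 2 (by omega)) (hρ 2)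
  obtain ⟨⟨a₁, ha₁, p, hp, h1⟩, hρ1⟩ := exists_affine_of_bind₁_eq_X
    (t := Function.update τ.coord 2 0) (i := 1) (P := ρ.coord) (fun l hl => by
      rcases eq_or_ne l 2 with rfl | hl2
      · simp
      · rw [Function.update_of_ne hl2]
        exact hmem l 1 (by omega)) (hρ2 1 (by decide) (hρ 1))
  obtain ⟨⟨a₀, ha₀, b, hb, h0⟩, -⟩ := exists_affine_of_bind₁_eq_X
    (t := Function.update (Function.update τ.coord 2 0) 1 0) (i := 0) (P := ρ.coord)
    (fun l hl => by
      rcases eq_or_ne l 1 with rfl | hl1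
      · simp
      · obtain rfl : l = 2 := by omega
        simp) (hρ1 0 (by decide) (hρ2 0 (by decide) (hρ 0)))
  rw [Function.update_of_ne (by decide)] at h1
  rw [Function.update_of_ne (by decide), Function.update_of_ne (by decide)] at h0
  have hsub : ∀ (i : Fin 3) (β : k) (r : MvPolynomial (Fin 3) k),
      τ.coord i = C β * X i + r → r ∈ supported k (Set.Iic i) := by
    intro i β r h
    have : r = τ.coord i - C β * X i := by rw [h]; ring
    rw [this]
    exact Subalgebra.sub_mem _ (hτ i) (Subalgebra.mul_mem _ (Subalgebra.algebraMap_mem _ β)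
      (X_mem_supported.2 (Set.mem_Iic.2 le_rfl)))
  have hp0 : p ∈ supported k {(0 : Fin 3)} := by
    rw [mem_supported]
    intro l hl
    have e1 : l ≠ 1 := mem_supported.1 hp hl
    have e2 : l ≤ 1 := mem_supported.1 (hsub 1 a₁ p h1) hl
    rw [Set.mem_singleton_iff]
    omega
  have hb0 : b ∈ supported k (∅ : Set (Fin 3)) := by
    rw [mem_supported]
    intro l hl
    have e1 : l ≠ 0 := mem_supported.1 hb hl
    have e2 : l ≤ 0 := mem_supported.1 (hsub 0 a₀ b h0) hl
    omega
  obtain ⟨p', rfl⟩ := exists_aeval_of_mem_supported_singleton hp0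
  rw [supported_empty] at hb0
  obtain ⟨b', rfl⟩ := Algebra.mem_bot.1 hb0
  exact ⟨a₀, a₁, a₂, b', p', q, ha₀, ha₁, ha₂,
    fun m hm => apply_eq_zero_of_mem_supported hq hm (by simp), h0, h1, h2⟩

end PolyEnd

/-! ### Linear, permutation and affine automorphisms -/

namespace PolyEnd

variable {k : Type*} [Field k] {n : ℕ}

/-- The linear endomorphism given by a matrix. -/
noncomputable def ofMatrix (A : Matrix (Fin n) (Fin n) k) : PolyEnd k n :=
  ⟨fun i => ∑ j, C (A i j) * X j⟩

/-- The endomorphism that permutes the coordinates. -/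
noncomputable def ofPerm (k : Type*) [Field k] (σ : Equiv.Perm (Fin n)) : PolyEnd k n :=
  ⟨fun i => X (σ i)⟩

theorem ofMatrix_mul (A B : Matrix (Fin n) (Fin n) k) :
    ofMatrix (A * B) = ofMatrix A * ofMatrix B := by
  refine PolyEnd.ext (funext fun i => ?_)
  rw [coord_mul]
  simp only [ofMatrix, map_sum, map_mul, bind₁_C_right, bind₁_X_right, Matrix.mul_apply,
    Finset.sum_mul, Finset.mul_sum]
  rw [Finset.sum_comm]
  simp only [mul_assoc]

theorem ofMatrix_one : ofMatrix (1 : Matrix (Fin n) (Fin n) k) = 1 := by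
  refine PolyEnd.ext (funext fun i => ?_)
  rw [coord_one]
  simp [ofMatrix, Matrix.one_apply, ite_mul]

theorem ofMatrix_permMatrix (σ : Equiv.Perm (Fin n)) : ofMatrix (σ.permMatrix k) = ofPerm k σ := by
  refine PolyEnd.ext (funext fun i => ?_)
  simp [ofMatrix, ofPerm, Equiv.Perm.permMatrix, PEquiv.toMatrix_apply]

theorem ofPerm_mul_inv (σ : Equiv.Perm (Fin n)) : ofPerm k σ * ofPerm k σ⁻¹ = 1 := by
  refine PolyEnd.ext (funext fun i => ?_)
  rw [coord_mul, coord_one]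
  simp [ofPerm]

theorem coord_ofPerm_mul (σ : Equiv.Perm (Fin n)) (τ : PolyEnd k n) (i : Fin n) :
    (ofPerm k σ * τ).coord i = τ.coord (σ i) := by
  rw [coord_mul]
  simp [ofPerm]

theorem isUnit_ofPerm (σ : Equiv.Perm (Fin n)) : IsUnit (ofPerm k σ) :=
  ⟨⟨ofPerm k σ, ofPerm k σ⁻¹, ofPerm_mul_inv σ, by
    simpa using ofPerm_mul_inv (k := k) σ⁻¹⟩, rfl⟩

theorem degree_ofMatrix_le (A : Matrix (Fin n) (Fin n) k) : (ofMatrix A).degree ≤ 1 := by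
  refine Finset.sup_le fun i _ => totalDegree_finsetSum_le fun j _ => ?_
  refine (totalDegree_mul _ _).trans ?_
  rw [totalDegree_C, totalDegree_X]

theorem degree_ofPerm (hn : 0 < n) (σ : Equiv.Perm (Fin n)) : (ofPerm k σ).degree = 1 := by
  refine le_antisymm (Finset.sup_le fun i _ => ?_) (one_le_degree hn (isUnit_ofPerm σ))
  exact (totalDegree_X (R := k) (σ i)).le

theorem isAffineAut_ofPerm (hn : 0 < n) (σ : Equiv.Perm (Fin n)) : (ofPerm k σ).IsAffineAut :=
  ⟨isUnit_ofPerm σ, degree_ofPerm hn σ⟩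

theorem isTriangular_ofMatrix {A : Matrix (Fin n) (Fin n) k}
    (hA : A.BlockTriangular OrderDual.toDual) : (ofMatrix A).IsTriangular := by
  intro i
  change ∑ j, C (A i j) * X j ∈ supported k (Set.Iic i)
  refine Subalgebra.sum_mem _ fun j _ => ?_
  rcases le_or_gt j i with hij | hij
  · exact Subalgebra.mul_mem _ (Subalgebra.algebraMap_mem _ _) (X_mem_supported.2 hij)
  · rw [hA (OrderDual.toDual_lt_toDual.2 hij), C_0, zero_mul]
    exact Subalgebra.zero_mem _

theorem eq_sum_of_totalDegree_le_one {p : MvPolynomial (Fin n) k} (hp : p.totalDegree ≤ 1) :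
    p = (∑ j, C (coeff (Finsupp.single j 1) p) * X j) + C (coeff 0 p) := by
  ext m
  rw [coeff_add, coeff_sum, coeff_C]
  simp only [coeff_C_mul, coeff_X]
  rcases eq_or_ne m 0 with rfl | hm
  · simp
  by_cases h1 : ∃ j, m = Finsupp.single j 1
  · obtain ⟨j, rfl⟩ := h1
    rw [Finset.sum_eq_single j, if_neg hm.symm]
    · simp
    · intro l _ hl
      simp [Finsupp.single_left_inj, hl]
    · simp
  · push Not at h1
    rw [Finset.sum_eq_zero, if_neg hm.symm, add_zero]
    · by_contra hc
      have hdeg := (le_totalDegree (mem_support_iff.2 hc)).trans hp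
      obtain ⟨j, hj⟩ := Finsupp.ne_iff.1 hm
      have hsum : ∑ l, m l ≤ 1 := by rwa [Finsupp.sum_fintype _ _ (by simp)] at hdeg
      refine h1 j (Finsupp.ext fun l => ?_)
      rw [Finsupp.coe_zero, Pi.zero_apply] at hj
      rcases eq_or_ne l j with rfl | hl
      · have := (Finset.single_le_sum (fun i _ => Nat.zero_le (m i)) (Finset.mem_univ l)).trans hsum
        rw [Finsupp.single_eq_same]
        omega
      · have h2 := (Finset.sum_le_sum_of_subset (f := fun i => m i)
          (Finset.subset_univ {l, j})).trans hsum
        rw [Finset.sum_pair hl] at h2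
        rw [Finsupp.single_eq_of_ne hl]
        omega
    · intro j _
      rw [if_neg (fun h => h1 j h.symm), mul_zero]

/-- An affine automorphism is a translation followed by an invertible linear map. -/
theorem IsAffineAut.exists_eq {α : PolyEnd k n} (hα : α.IsAffineAut) :
    ∃ (A : Matrix (Fin n) (Fin n) k) (t : PolyEnd k n),
      A.det ≠ 0 ∧ t.IsTriangular ∧ α = ofMatrix A * t := by
  obtain ⟨⟨u, rfl⟩, hdeg⟩ := hα
  set α : PolyEnd k n := (u : PolyEnd k n)
  set β : PolyEnd k n := (↑u⁻¹ : PolyEnd k n)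
  set A : Matrix (Fin n) (Fin n) k :=
    Matrix.of fun i j => coeff (Finsupp.single j 1) (α.coord i) with hA
  have hα : ∀ i, α.coord i = (∑ j, C (A i j) * X j) + C (coeff 0 (α.coord i)) := fun i =>
    eq_sum_of_totalDegree_le_one ((totalDegree_coord_le α i).trans hdeg.le)
  -- A linear relation among the rows of `A` would make a combination of the coordinates of `α`
  -- constant; composing with the inverse of `α` would make the same combination of the variables
  -- constant.
  have hdet : A.det ≠ 0 := by
    intro h
    obtain ⟨v, hv, hvA⟩ := Matrix.exists_vecMul_eq_zero_iff.2 h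
    have hconst : ∑ i, C (v i) * α.coord i = C (∑ i, v i * coeff 0 (α.coord i)) := by
      have : ∑ i, C (v i) * α.coord i = (∑ j, C (Matrix.vecMul v A j) * X j) +
          C (∑ i, v i * coeff 0 (α.coord i)) := by
        conv_lhs => enter [2, i]; rw [hα i, mul_add, Finset.mul_sum]
        rw [Finset.sum_add_distrib, Finset.sum_comm]
        simp only [Matrix.vecMul, dotProduct, map_sum, map_mul, Finset.sum_mul, mul_assoc]
      rw [this, hvA]
      simp
    generalize ∑ i, v i * coeff 0 (α.coord i) = c at hconst
    have hβ : ∀ i, bind₁ β.coord (α.coord i) = X i := fun i =>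
      congrFun (congrArg PolyEnd.coord (Units.mul_inv u)) i
    have h2 := congrArg (bind₁ β.coord) hconst
    simp only [map_sum, map_mul, bind₁_C_right, hβ] at h2
    obtain ⟨j, hj⟩ := Function.ne_iff.1 hv
    have h3 := congrArg (coeff (Finsupp.single j 1)) h2
    simp [coeff_sum, coeff_C_mul, coeff_X, Finsupp.single_left_inj] at h3
    rw [if_neg (Finsupp.single_ne_zero.2 one_ne_zero).symm] at h3
    exact hj h3
  set b : Fin n → k := Matrix.mulVec A⁻¹ fun i => coeff 0 (α.coord i) with hb
  have hAb : ∀ i, ∑ j, A i j * b j = coeff 0 (α.coord i) := by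
    intro i
    have : Matrix.mulVec A b = fun i => coeff 0 (α.coord i) := by
      rw [hb, Matrix.mulVec_mulVec, Matrix.mul_nonsing_inv _ (isUnit_iff_ne_zero.2 hdet),
        Matrix.one_mulVec]
    exact congrFun this i
  refine ⟨A, ⟨fun i => X i + C (b i)⟩, hdet, fun i => ?_, PolyEnd.ext (funext fun i => ?_)⟩
  · exact Subalgebra.add_mem _ (X_mem_supported.2 (Set.mem_Iic.2 le_rfl))
      (Subalgebra.algebraMap_mem _ _)
  · rw [coord_mul, hα i, ← hAb i]
    simp [ofMatrix, mul_add, Finset.sum_add_distrib]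

end PolyEnd

/-! ### Bruhat decomposition in size three -/

namespace Matrix

variable {k : Type*} [Field k]

/-- `A` and `A'` agree up to lower triangular factors on both sides, the left one invertible. -/
def LowerEquiv (A A' : Matrix (Fin 3) (Fin 3) k) : Prop :=
  ∃ B C : Matrix (Fin 3) (Fin 3) k, B.BlockTriangular OrderDual.toDual ∧ B.det ≠ 0 ∧
    C.BlockTriangular OrderDual.toDual ∧ A = B * A' * C

theorem LowerEquiv.trans {A A' A'' : Matrix (Fin 3) (Fin 3) k} (h : LowerEquiv A A')
    (h' : LowerEquiv A' A'') : LowerEquiv A A'' := by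
  obtain ⟨B, C, hB, hBd, hC, rfl⟩ := h
  obtain ⟨B', C', hB', hBd', hC', rfl⟩ := h'
  refine ⟨B * B', C' * C, hB.mul hB', ?_, hC'.mul hC, by simp only [Matrix.mul_assoc]⟩
  rw [det_mul]
  exact mul_ne_zero hBd hBd'

theorem blockTriangular_lower_three (a b c d e f : k) :
    (!![a, 0, 0; b, c, 0; d, e, f]).BlockTriangular OrderDual.toDual := by
  intro i j hij
  rw [OrderDual.toDual_lt_toDual] at hij
  fin_cases i <;> fin_cases j <;> first | rfl | exact absurd hij (by decide)

theorem lowerEquiv_of_eq {A A' : Matrix (Fin 3) (Fin 3) k} (x y z a b c d e f : k)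
    (h : A = !![1, 0, 0; x, 1, 0; y, z, 1] * A' * !![a, 0, 0; b, c, 0; d, e, f]) :
    LowerEquiv A A' :=
  ⟨_, _, blockTriangular_lower_three _ _ _ _ _ _, by simp [det_fin_three],
    blockTriangular_lower_three _ _ _ _ _ _, h⟩

theorem permMatrix_eq_of {σ : Equiv.Perm (Fin 3)} {A : Matrix (Fin 3) (Fin 3) k}
    (h : ∀ i j, A i j = if σ i = j then 1 else 0) : σ.permMatrix k = A := by
  ext i j
  rw [h, Equiv.Perm.permMatrix, PEquiv.toMatrix_apply]
  simp [eq_comm]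

/-- The Bruhat decomposition of an invertible `3 × 3` matrix. -/
theorem exists_lowerEquiv_permMatrix {A : Matrix (Fin 3) (Fin 3) k} (hA : A.det ≠ 0) :
    ∃ σ : Equiv.Perm (Fin 3), LowerEquiv A (σ.permMatrix k) := by
  have hperm : ∀ (σ : Equiv.Perm (Fin 3)) (P : Matrix (Fin 3) (Fin 3) k),
      (∀ i j, P i j = if σ i = j then 1 else 0) → LowerEquiv A P →
      ∃ σ : Equiv.Perm (Fin 3), LowerEquiv A (σ.permMatrix k) := fun σ P h hP =>
    ⟨σ, by rwa [permMatrix_eq_of h]⟩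
  rw [det_fin_three] at hA
  -- Elimination with the rightmost nonzero entry of a row as pivot: the left lower triangular
  -- factor clears the column below it, the right one clears the entries to its left. The first row
  -- is treated here, the second inside each case.
  by_cases h02 : A 0 2 = 0
  · by_cases h01 : A 0 1 = 0
    · have h00 : A 0 0 ≠ 0 := by
        intro h
        simp [h, h01, h02] at hA
      have h1 : LowerEquiv A !![A 0 0, 0, 0; 0, A 1 1, A 1 2; 0, A 2 1, A 2 2] := by
        refine lowerEquiv_of_eq (A 1 0 / A 0 0) (A 2 0 / A 0 0) 0 1 0 1 0 0 1 ?_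
        ext i j
        fin_cases i <;> fin_cases j <;>
          simp [Matrix.mul_apply, Fin.sum_univ_three, h00, h01, h02]
      by_cases h12 : A 1 2 = 0
      · have h11 : A 1 1 ≠ 0 := by
          intro h
          simp [h, h12, h01, h02] at hA
        refine hperm 1 !![1, 0, 0; 0, 1, 0; 0, 0, 1] ?_ (h1.trans ?_)
        · intro i j; fin_cases i <;> fin_cases j <;> rfl
        · refine lowerEquiv_of_eq 0 0 (A 2 1 / A 1 1) (A 0 0) 0 (A 1 1) 0 0 (A 2 2) ?_
          ext i j
          fin_cases i <;> fin_cases j <;>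
            simp [Matrix.mul_apply, Fin.sum_univ_three, h11, h12]
      · refine hperm (Equiv.swap 1 2) !![1, 0, 0; 0, 0, 1; 0, 1, 0] ?_ (h1.trans ?_)
        · intro i j; fin_cases i <;> fin_cases j <;> rfl
        · refine lowerEquiv_of_eq 0 0 (A 2 2 / A 1 2) (A 0 0) 0
            (A 2 1 - A 2 2 / A 1 2 * A 1 1) 0 (A 1 1) (A 1 2) ?_
          ext i j
          fin_cases i <;> fin_cases j <;>
            simp [Matrix.mul_apply, Fin.sum_univ_three, h12]
    · have h1 : LowerEquiv A !![0, A 0 1, 0; A 1 0 - A 1 1 * A 0 0 / A 0 1, 0, A 1 2;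
          A 2 0 - A 2 1 * A 0 0 / A 0 1, 0, A 2 2] := by
        refine lowerEquiv_of_eq (A 1 1 / A 0 1) (A 2 1 / A 0 1) 0 1 (A 0 0 / A 0 1) 1 0 0 1 ?_
        ext i j
        fin_cases i <;> fin_cases j <;>
          simp [Matrix.mul_apply, Fin.sum_univ_three, h01, h02] <;> field_simp <;> ring
      generalize hp : A 1 0 - A 1 1 * A 0 0 / A 0 1 = p at h1
      generalize A 2 0 - A 2 1 * A 0 0 / A 0 1 = r at h1
      by_cases h12 : A 1 2 = 0
      · have hp0 : p ≠ 0 := by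
          rintro rfl
          rw [sub_eq_zero, eq_div_iff h01] at hp
          apply hA
          rw [h02, h12]
          linear_combination (-A 2 2) * hp
        refine hperm (Equiv.swap 0 1) !![0, 1, 0; 1, 0, 0; 0, 0, 1] ?_ (h1.trans ?_)
        · intro i j; fin_cases i <;> fin_cases j <;> rfl
        · refine lowerEquiv_of_eq 0 0 (r / p) p 0 (A 0 1) 0 0 (A 2 2) ?_
          ext i j
          fin_cases i <;> fin_cases j <;>
            simp [Matrix.mul_apply, Fin.sum_univ_three, hp0, h12]
      · refine hperm (finRotate 3) !![0, 1, 0; 0, 0, 1; 1, 0, 0] ?_ (h1.trans ?_)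
        · intro i j; fin_cases i <;> fin_cases j <;> rfl
        · refine lowerEquiv_of_eq 0 0 (A 2 2 / A 1 2) (r - A 2 2 / A 1 2 * p) 0 (A 0 1) p 0
            (A 1 2) ?_
          ext i j
          fin_cases i <;> fin_cases j <;>
            simp [Matrix.mul_apply, Fin.sum_univ_three, h12]
  · have h1 : LowerEquiv A !![0, 0, A 0 2;
        A 1 0 - A 1 2 * A 0 0 / A 0 2, A 1 1 - A 1 2 * A 0 1 / A 0 2, 0;
        A 2 0 - A 2 2 * A 0 0 / A 0 2, A 2 1 - A 2 2 * A 0 1 / A 0 2, 0] := by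
      refine lowerEquiv_of_eq (A 1 2 / A 0 2) (A 2 2 / A 0 2) 0 1 0 1 (A 0 0 / A 0 2)
        (A 0 1 / A 0 2) 1 ?_
      ext i j
      fin_cases i <;> fin_cases j <;>
        simp [Matrix.mul_apply, Fin.sum_univ_three, h02] <;> field_simp <;> ring
    generalize hp : A 1 0 - A 1 2 * A 0 0 / A 0 2 = p at h1
    generalize hq : A 1 1 - A 1 2 * A 0 1 / A 0 2 = q at h1
    generalize A 2 0 - A 2 2 * A 0 0 / A 0 2 = r at h1
    generalize A 2 1 - A 2 2 * A 0 1 / A 0 2 = s at h1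
    by_cases hq0 : q = 0
    · subst hq0
      have hp0 : p ≠ 0 := by
        rintro rfl
        rw [sub_eq_zero, eq_div_iff h02] at hp hq
        apply hA
        have : A 0 2 * (A 0 0 * A 1 1 * A 2 2 - A 0 0 * A 1 2 * A 2 1 - A 0 1 * A 1 0 * A 2 2 +
            A 0 1 * A 1 2 * A 2 0 + A 0 2 * A 1 0 * A 2 1 - A 0 2 * A 1 1 * A 2 0) = 0 := by
          linear_combination (A 0 2 * A 2 1 - A 0 1 * A 2 2) * hp +
            (A 0 0 * A 2 2 - A 0 2 * A 2 0) * hq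
        exact (mul_eq_zero.1 this).resolve_left h02
      refine hperm (finRotate 3)⁻¹ !![0, 0, 1; 1, 0, 0; 0, 1, 0] ?_ (h1.trans ?_)
      · intro i j; fin_cases i <;> fin_cases j <;> rfl
      · refine lowerEquiv_of_eq 0 0 (r / p) p 0 s 0 0 (A 0 2) ?_
        ext i j
        fin_cases i <;> fin_cases j <;>
          simp [Matrix.mul_apply, Fin.sum_univ_three, hp0]
    · refine hperm (Equiv.swap 0 2) !![0, 0, 1; 0, 1, 0; 1, 0, 0] ?_ (h1.trans ?_)
      · intro i j; fin_cases i <;> fin_cases j <;> rfl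
      · refine lowerEquiv_of_eq 0 0 (s / q) (r - s / q * p) p q 0 0 (A 0 2) ?_
        ext i j
        fin_cases i <;> fin_cases j <;>
          simp [Matrix.mul_apply, Fin.sum_univ_three, hq0]

end Matrix

/-! ### Reduction to permuted triangular automorphisms -/

namespace PolyEnd

variable {k : Type*} [Field k]

/-- An affine-triangular automorphism is conjugate to a permutation of the coordinates of a
triangular automorphism of at most the same degree. -/
theorem IsAffineTriangular.exists_conj {f : PolyEnd k 3} (hf : IsUnit f)
    (h : f.IsAffineTriangular) :
    ∃ (σ : Equiv.Perm (Fin 3)) (τ : PolyEnd k 3), τ.IsTriangular ∧ IsUnit τ ∧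
      τ.degree ≤ f.degree ∧ f.dynamicalDegree = (ofPerm k σ * τ).dynamicalDegree := by
  obtain ⟨α, τ, hα, hτ, rfl⟩ := h
  obtain ⟨A, t, hA, ht, rfl⟩ := hα.exists_eq
  obtain ⟨σ, B, C, hB, hBd, hC, rfl⟩ := Matrix.exists_lowerEquiv_permMatrix hA
  set f := ofMatrix (B * σ.permMatrix k * C) * t * τ with hfdef
  -- Conjugating by `B` moves it from the left of the permutation to the far right, where it joins
  -- the triangular factors.
  set τ' := ofMatrix C * t * τ * ofMatrix B with hτ'
  have h1 : ofMatrix B⁻¹ * ofMatrix B = 1 := by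
    rw [← ofMatrix_mul, Matrix.nonsing_inv_mul _ (isUnit_iff_ne_zero.2 hBd), ofMatrix_one]
  have h2 : ofMatrix B * ofMatrix B⁻¹ = 1 := by
    rw [← ofMatrix_mul, Matrix.mul_nonsing_inv _ (isUnit_iff_ne_zero.2 hBd), ofMatrix_one]
  have hconj : ofPerm k σ * τ' = ofMatrix B⁻¹ * f * ofMatrix B := by
    rw [hfdef, hτ', ofMatrix_mul, ofMatrix_mul, ofMatrix_permMatrix]
    calc _ = (ofMatrix B⁻¹ * ofMatrix B) * (ofPerm k σ * (ofMatrix C * t * τ * ofMatrix B)) := by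
          rw [h1, one_mul]
      _ = _ := by simp only [mul_assoc]
  obtain ⟨hu, hdyn⟩ := dynamicalDegree_eq_of_conj (by norm_num) hf h1 h2 hconj
  -- Invertibility and the degree bound for `τ'` come from `f` through this identity, since the
  -- triangular factor `τ` carries no degree bound of its own.
  have hτ'eq : τ' = ofPerm k σ⁻¹ * (ofPerm k σ * τ') := by
    rw [← mul_assoc]
    have := ofPerm_mul_inv (k := k) σ⁻¹
    rw [inv_inv] at this
    rw [this, one_mul]
  refine ⟨σ, τ', (((isTriangular_ofMatrix hC).mul ht).mul hτ).mul (isTriangular_ofMatrix hB),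
    ?_, ?_, hdyn.symm⟩
  · rw [hτ'eq]
    exact (isUnit_ofPerm _).mul hu
  · rw [hτ'eq, hconj]
    refine (degree_mul_le _ _).trans ?_
    rw [degree_ofPerm (by norm_num), one_mul]
    refine (degree_mul_le _ _).trans ?_
    calc _ ≤ (1 * f.degree) * 1 := by
          gcongr
          · exact (degree_mul_le _ _).trans (Nat.mul_le_mul_right _ (degree_ofMatrix_le _))
          · exact degree_ofMatrix_le B
      _ = f.degree := by simp

end PolyEnd

/-! ### The quadratic numbers -/

namespace PolyEnd

variable {k : Type*} [Field k]

/-- The nonnegative root of `t ^ 2 = a * t + b * c`. -/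
noncomputable def quadraticRoot (a b c : ℕ) : ℝ :=
  ((a : ℝ) + √((a : ℝ) ^ 2 + 4 * (b : ℝ) * (c : ℝ))) / 2

theorem quadraticRoot_sq (a b c : ℕ) :
    quadraticRoot a b c ^ 2 = a * quadraticRoot a b c + b * c := by
  have h := Real.sq_sqrt (show (0 : ℝ) ≤ (a : ℝ) ^ 2 + 4 * (b : ℝ) * (c : ℝ) by positivity)
  unfold quadraticRoot
  linear_combination h / 4

theorem natCast_le_quadraticRoot (a b c : ℕ) : (a : ℝ) ≤ quadraticRoot a b c := by
  have h : (a : ℝ) ≤ √((a : ℝ) ^ 2 + 4 * (b : ℝ) * (c : ℝ)) :=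
    Real.le_sqrt_of_sq_le (by
      have : (0 : ℝ) ≤ 4 * (b : ℝ) * (c : ℝ) := by positivity
      linarith)
  unfold quadraticRoot
  linarith

theorem eq_quadraticRoot {a b c : ℕ} {θ : ℝ} (hθ : 0 < θ) (h : a * θ + b * c = θ ^ 2) :
    θ = quadraticRoot a b c := by
  have hbc : (0 : ℝ) ≤ b * c := by positivity
  have haθ : (a : ℝ) ≤ θ := by
    by_contra! hlt
    nlinarith
  have hs : √((a : ℝ) ^ 2 + 4 * (b : ℝ) * (c : ℝ)) = 2 * θ - a := by
    rw [show (a : ℝ) ^ 2 + 4 * (b : ℝ) * (c : ℝ) = (2 * θ - a) ^ 2 by linear_combination 4 * h]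
    exact Real.sqrt_sq (by linarith)
  unfold quadraticRoot
  rw [hs]
  ring

/-- With `l` the root, `t² - a t - b c = (t - l)(t + l - a)`, and `l ≥ a`. Hence the largest root
satisfies the inequalities attached to all the other monomials. -/
theorem le_sq_of_quadraticRoot_le {a b c : ℕ} {t : ℝ} (h : quadraticRoot a b c ≤ t) :
    a * t + b * c ≤ t ^ 2 := by
  have h1 := quadraticRoot_sq a b c
  have h2 := natCast_le_quadraticRoot a b c
  have h3 : (0 : ℝ) ≤ a := Nat.cast_nonneg a
  nlinarith [mul_nonneg (sub_nonneg.2 h) (by linarith : (0 : ℝ) ≤ t + quadraticRoot a b c - a)]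

theorem one_le_quadraticRoot {a b c : ℕ} (h : quadraticRoot a b c ≠ 0) :
    1 ≤ quadraticRoot a b c := by
  have h1 := quadraticRoot_sq a b c
  have h2 := natCast_le_quadraticRoot a b c
  rcases Nat.eq_zero_or_pos a with rfl | ha
  · rcases Nat.eq_zero_or_pos (b * c) with hbc | hbc
    · exfalso
      have : (b : ℝ) * c = 0 := by exact_mod_cast hbc
      rw [this] at h1
      simp at h1
      exact h h1
    · have : (1 : ℝ) ≤ b * c := by exact_mod_cast hbc
      rw [Nat.cast_zero, zero_mul, zero_add] at h1
      rw [Nat.cast_zero] at h2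
      nlinarith
  · have : (1 : ℝ) ≤ a := by exact_mod_cast ha
    linarith

/-- The largest of the roots attached to a finite set of exponents, and of `1`. -/
theorem exists_max_quadraticRoot (S : Finset (Fin 3 →₀ ℕ)) (c : ℕ) :
    ∃ θ : ℝ, 1 ≤ θ ∧ (∀ m ∈ S, m 0 * θ + m 1 * c ≤ θ ^ 2) ∧
      (θ = 1 ∨ ∃ m ∈ S, m 0 * θ + m 1 * c = θ ^ 2) := by
  rcases S.eq_empty_or_nonempty with rfl | hS
  · exact ⟨1, le_rfl, by simp, Or.inl rfl⟩
  obtain ⟨m, hm, hmax⟩ := S.exists_max_image (fun m => quadraticRoot (m 0) (m 1) c) hS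
  refine ⟨max 1 (quadraticRoot (m 0) (m 1) c), le_max_left _ _, fun m' hm' =>
    le_sq_of_quadraticRoot_le ((hmax m' hm').trans (le_max_right _ _)), ?_⟩
  rcases max_choice 1 (quadraticRoot (m 0) (m 1) c) with h | h
  · exact Or.inl h
  · rw [h]
    exact Or.inr ⟨m, hm, (quadraticRoot_sq _ _ _).symm⟩

/-- The numbers that occur as dynamical degrees in degree at most `d`. -/
def IsQuadraticOfDegreeLE (d : ℕ) (l : ℝ) : Prop :=
  ∃ a b c : ℕ, a + b ≤ d ∧ c ≤ d ∧ l = quadraticRoot a b c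

theorem isQuadraticOfDegreeLE_natCast {d M : ℕ} (h1 : 1 ≤ M) (h : M ≤ d) :
    IsQuadraticOfDegreeLE d M := by
  refine ⟨M, 0, 0, h, Nat.zero_le d, eq_quadraticRoot (by exact_mod_cast h1) ?_⟩
  simp [pow_two]

theorem apply_add_apply_le_totalDegree {q : MvPolynomial (Fin 3) k} {m : Fin 3 →₀ ℕ}
    (hm : m ∈ q.support) : m 0 + m 1 ≤ q.totalDegree := by
  refine le_trans ?_ (le_totalDegree hm)
  rw [Finsupp.sum_fintype _ _ (by simp), Fin.sum_univ_three]
  omega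

theorem bind₁_congr_of_apply_two_eq_zero {q : MvPolynomial (Fin 3) k}
    (hq : ∀ m ∈ q.support, m 2 = 0) {f g : Fin 3 → MvPolynomial (Fin 3) k} (h0 : f 0 = g 0)
    (h1 : f 1 = g 1) : bind₁ f q = bind₁ g q := by
  refine hom_congr_vars (f₁ := (bind₁ f).toRingHom) (f₂ := (bind₁ g).toRingHom) ?_ ?_ rfl
  · ext a : 1
    exact (bind₁_C_right f a).trans (bind₁_C_right g a).symm
  · intro i hi _
    change bind₁ f (X i) = bind₁ g (X i)
    rw [bind₁_X_right, bind₁_X_right]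
    obtain ⟨m, hm, hmi⟩ := (mem_vars_iff_mem_support i).1 hi
    fin_cases i
    · exact h0
    · exact h1
    · exact absurd (hq m hm) (Finsupp.mem_support_iff.1 hmi)

theorem weightIn_totalDegree_mul {q : MvPolynomial (Fin 3) k} (hq : ∀ m ∈ q.support, m 2 = 0)
    {w : Fin 3 → ℝ} {K : ℝ} (hK : 0 ≤ K) (h0 : w 0 ≤ K) (h1 : w 1 ≤ K) :
    WeightIn w (Set.Iic (q.totalDegree * K)) q := by
  intro m hm
  have h : (m 0 : ℝ) + m 1 ≤ q.totalDegree := by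
    exact_mod_cast apply_add_apply_le_totalDegree hm
  rw [weight_fin_three, hq m hm, Nat.cast_zero, zero_mul, add_zero, Set.mem_Iic]
  calc (m 0 : ℝ) * w 0 + m 1 * w 1 ≤ m 0 * K + m 1 * K := by gcongr
    _ = (m 0 + m 1) * K := by ring
    _ ≤ _ := mul_le_mul_of_nonneg_right h hK

/-! ### The six permutations -/

variable {f : PolyEnd k 3} {a₀ a₁ a₂ b : k} {p : Polynomial k} {q : MvPolynomial (Fin 3) k} {d : ℕ}

/-- The weights of `x₂` and `x₃` are chosen large enough to dominate `p(x₁)` and `q(x₁, x₂)`, so no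
weighted degree grows. -/
theorem dynamicalDegree_eq_one_of_triangular (hf : IsUnit f) (hq : ∀ m ∈ q.support, m 2 = 0)
    (h0 : f.coord 0 = C a₀ * X 0 + C b) (h1 : f.coord 1 = C a₁ * X 1 + Polynomial.aeval (X 0) p)
    (h2 : f.coord 2 = C a₂ * X 2 + q) : f.dynamicalDegree = 1 := by
  refine le_antisymm ?_ (one_le_dynamicalDegree (by norm_num) hf)
  set K : ℝ := (p.natDegree : ℝ) + 1 with hK
  have hK1 : 1 ≤ K := by
    rw [hK]
    have : (0 : ℝ) ≤ p.natDegree := Nat.cast_nonneg _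
    linarith
  set L : ℝ := q.totalDegree * K + 1 with hL
  have hL1 : 0 < L := by positivity
  set w : Fin 3 → ℝ := ![1, K, L]
  have w0 : w 0 = 1 := rfl
  have w1 : w 1 = K := rfl
  have w2 : w 2 = L := rfl
  refine dynamicalDegree_le_of_weightIn (w := w) (by norm_num) hf ?_ one_pos ?_
  · intro i
    fin_cases i
    · exact one_pos
    · exact zero_lt_one.trans_le hK1
    · exact hL1
  · intro i
    rw [one_mul]
    fin_cases i
    · change WeightIn w (Set.Iic (w 0)) (f.coord 0)
      rw [h0]
      exact (weightIn_C_mul_X a₀ 0 (Set.mem_Iic.2 le_rfl)).add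
        (weightIn_C b (Set.mem_Iic.2 zero_le_one))
    · change WeightIn w (Set.Iic (w 1)) (f.coord 1)
      rw [h1]
      refine (weightIn_C_mul_X a₁ 1 (Set.mem_Iic.2 le_rfl)).add
        (((weightIn_X 0 (Set.mem_Iic.2 le_rfl)).aeval (by rw [w0]; exact zero_le_one) p).mono
          (Set.Iic_subset_Iic.2 ?_))
      rw [w0, w1, hK]
      linarith
    · change WeightIn w (Set.Iic (w 2)) (f.coord 2)
      rw [h2]
      refine (weightIn_C_mul_X a₂ 2 (Set.mem_Iic.2 le_rfl)).add
        ((weightIn_totalDegree_mul hq (by linarith) (by rw [w0]; exact hK1) w1.le).mono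
          (Set.Iic_subset_Iic.2 ?_))
      rw [w2, hL]
      linarith

/-- The first two coordinates form a plane map of Hénon type, with growth rate `deg p` when this
exceeds `1`. The third does not feed back into them, and a large weight for `x₃` absorbs `q`. -/
theorem dynamicalDegree_eq_max_natDegree (hf : IsUnit f) (hq : ∀ m ∈ q.support, m 2 = 0)
    (h0 : f.coord 0 = C a₁ * X 1 + Polynomial.aeval (X 0) p)
    (h1 : f.coord 1 = C a₀ * X 0 + C b)
    (h2 : f.coord 2 = C a₂ * X 2 + q) : f.dynamicalDegree = (max 1 p.natDegree : ℕ) := by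
  set θ : ℝ := ((max 1 p.natDegree : ℕ) : ℝ) with hθdef
  have hθ1 : 1 ≤ θ := by
    rw [hθdef]
    exact_mod_cast le_max_left 1 p.natDegree
  have hθp : (p.natDegree : ℝ) ≤ θ := by
    rw [hθdef]
    exact_mod_cast le_max_right 1 p.natDegree
  set L : ℝ := (q.totalDegree : ℝ) + 1 with hL
  have hL1 : 0 < L := by positivity
  set w : Fin 3 → ℝ := ![1, 1, L]
  have w0 : w 0 = 1 := rfl
  have w1 : w 1 = 1 := rfl
  have w2 : w 2 = L := rfl
  have hqw : WeightIn w (Set.Iio L) q := by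
    refine (weightIn_totalDegree_mul hq zero_le_one w0.le w1.le).mono (Set.Iic_subset_Iio.2 ?_)
    rw [hL]
    linarith
  have hX0 : IsLead w 1 (X 0 : MvPolynomial (Fin 3) k) (X 0) := isLead_X 0
  have hp := hX0.aeval one_pos p
  rw [mul_one] at hp
  apply le_antisymm
  · refine dynamicalDegree_le_of_weightIn (w := w) (by norm_num) hf ?_ (by linarith) ?_
    · intro i
      fin_cases i
      · exact one_pos
      · exact one_pos
      · exact hL1
    · intro i
      fin_cases i
      · change WeightIn w (Set.Iic (θ * w 0)) (f.coord 0)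
        rw [h0, w0, mul_one]
        exact (weightIn_C_mul_X a₁ 1 (Set.mem_Iic.2 hθ1)).add
          (hp.weightIn.mono (Set.Iic_subset_Iic.2 hθp))
      · change WeightIn w (Set.Iic (θ * w 1)) (f.coord 1)
        rw [h1, w1, mul_one]
        exact (weightIn_C_mul_X a₀ 0 (Set.mem_Iic.2 hθ1)).add
          (weightIn_C b (Set.mem_Iic.2 (by linarith)))
      · change WeightIn w (Set.Iic (θ * w 2)) (f.coord 2)
        rw [h2, w2]
        refine (weightIn_C_mul_X a₂ 2 (Set.mem_Iic.2 ?_)).add (hqw.mono fun x hx =>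
          Set.mem_Iic.2 (le_trans (le_of_lt hx) ?_))
        · rw [w2]
          nlinarith
        · nlinarith
  rcases le_or_gt p.natDegree 1 with hc | hc
  · rw [hθdef, max_eq_left hc, Nat.cast_one]
    exact one_le_dynamicalDegree (by norm_num) hf
  have hθc : θ = p.natDegree := by rw [hθdef, max_eq_right hc.le]
  have hθ : 1 < θ := by
    rw [hθc]
    exact_mod_cast hc
  have hs : p.leadingCoeff ≠ 0 := by
    rw [Polynomial.leadingCoeff_ne_zero]
    rintro rfl
    simp at hc
  let g : PolyEnd k 3 := ⟨![C p.leadingCoeff * X 0 ^ p.natDegree, 0, 0]⟩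
  refine le_dynamicalDegree_of_isLead (w := w) (g := g) (i := 0) (by norm_num) hf (by linarith)
    ?_ one_pos (coord_pow_ne_zero_of_eq_pow hs rfl)
  intro i
  fin_cases i
  · change IsLead w (θ * w 0) (f.coord 0) (C p.leadingCoeff * X 0 ^ p.natDegree)
    rw [h0, w0, mul_one, add_comm, hθc]
    exact hp.add_lt (weightIn_C_mul_X a₁ 1 (Set.mem_Iio.2 (hθc ▸ hθ)))
  · change IsLead w (θ * w 1) (f.coord 1) 0
    rw [h1, w1, mul_one]
    exact ((weightIn_C_mul_X a₀ 0 (Set.mem_Iio.2 hθ)).add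
      (weightIn_C b (Set.mem_Iio.2 (by linarith)))).isLead_zero
  · change IsLead w (θ * w 2) (f.coord 2) 0
    rw [h2, w2]
    refine WeightIn.isLead_zero ((weightIn_C_mul_X a₂ 2 (Set.mem_Iio.2 ?_)).add
      (hqw.mono fun x hx => Set.mem_Iio.2 (lt_of_lt_of_le hx ?_)))
    · rw [w2]
      nlinarith
    · nlinarith

theorem isQuadratic_of_affine_coord (hf : IsUnit f) (hd : 1 ≤ d) (ha₁ : a₁ ≠ 0)
    (hq : ∀ m ∈ q.support, m 2 = 0)
    (hqd : q.totalDegree ≤ d) (h0 : f.coord 0 = C a₂ * X 2 + q) (h1 : f.coord 1 = C a₁ * X 1 + C b)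
    (h2 : f.coord 2 = C a₀ * X 0 + Polynomial.aeval (X 1) p) :
    IsQuadraticOfDegreeLE d f.dynamicalDegree := by
  set M : ℕ := max 1 (q.support.sup fun m => m 0) with hM
  rw [dynamicalDegree_eq_of_affine hf ha₁ h0 hq h1 h2 (M := M) (le_max_left _ _)
    (fun m hm => (Finset.le_sup (f := fun m : Fin 3 →₀ ℕ => m 0) hm).trans (le_max_right _ _))]
  · refine isQuadraticOfDegreeLE_natCast (le_max_left _ _) (max_le hd (Finset.sup_le fun m hm => ?_))
    have := apply_add_apply_le_totalDegree hm
    omega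
  · rcases max_choice 1 (q.support.sup fun m => m 0) with h | h
    · exact Or.inl (hM.trans h)
    · rcases q.support.eq_empty_or_nonempty with he | hne
      · left
        rw [hM, he, Finset.sup_empty]
        rfl
      · right
        obtain ⟨m, hm, hm'⟩ := Finset.exists_mem_eq_sup _ hne fun m : Fin 3 →₀ ℕ => m 0
        exact ⟨m, hm, by rw [hM, h, hm']⟩

/-- Exchanging `x₁` and `x₂` by conjugation leads to `isQuadratic_of_affine_coord`. -/
theorem isQuadratic_of_swap_one_two (hf : IsUnit f) (hd : 1 ≤ d) (ha₀ : a₀ ≠ 0)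
    (hq : ∀ m ∈ q.support, m 2 = 0)
    (hqd : q.totalDegree ≤ d) (h0 : f.coord 0 = C a₀ * X 0 + C b) (h1 : f.coord 1 = C a₂ * X 2 + q)
    (h2 : f.coord 2 = C a₁ * X 1 + Polynomial.aeval (X 0) p) :
    IsQuadraticOfDegreeLE d f.dynamicalDegree := by
  set s : Equiv.Perm (Fin 3) := Equiv.swap 0 1 with hs
  have hss : ofPerm k s * ofPerm k s = 1 := by
    have := ofPerm_mul_inv (k := k) s
    rwa [hs, Equiv.swap_inv] at this
  obtain ⟨hu, hdyn⟩ := dynamicalDegree_eq_of_conj (by norm_num) hf hss hss rfl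
  rw [← hdyn]
  have hc : ∀ i, (ofPerm k s * f * ofPerm k s).coord i = bind₁ (fun j => X (s j)) (f.coord (s i)) :=
    fun i => by rw [coord_mul, coord_ofPerm_mul]; rfl
  have s0 : s 0 = 1 := rfl
  have s1 : s 1 = 0 := rfl
  have s2 : s 2 = 2 := rfl
  have hX : ∀ i : Fin 3, i ≠ 2 → ∀ m ∈ (X i : MvPolynomial (Fin 3) k).support, m 2 = 0 := by
    intro i hi m hm
    rw [support_X, Finset.mem_singleton] at hm
    subst hm
    simp [hi.symm]
  refine isQuadratic_of_affine_coord (p := p) (q := bind₁ (fun j => X (s j)) q) (a₂ := a₂) (b := b)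
    (a₁ := a₀) (a₀ := a₁) hu hd ha₀ ?_ ?_ ?_ ?_ ?_
  · refine apply_two_eq_zero_of_bind₁ hq ?_ ?_ ?_
    · exact hX _ (by decide)
    · exact hX _ (by decide)
    · intro m hm
      rw [support_X, Finset.mem_singleton] at hm
      subst hm
      rw [s2, Finsupp.single_eq_same]
  · have : bind₁ (fun j => X (s j)) q = rename s q :=
      DFunLike.congr_fun (algHom_ext fun i => by rw [bind₁_X_right, rename_X]) q
    rw [this]
    exact (totalDegree_rename_le s q).trans hqd
  · rw [hc, s0, h1, map_add, map_mul, bind₁_C_right, bind₁_X_right, s2]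
  · rw [hc, s1, h0, map_add, map_mul, bind₁_C_right, bind₁_C_right, bind₁_X_right, s0]
  · rw [hc, s2, h2, map_add, map_mul, bind₁_C_right, bind₁_X_right, bind₁_aeval, bind₁_X_right,
      s0, s1]

theorem isQuadratic_of_swap_zero_two (hf : IsUnit f) (hd : 1 ≤ d) (ha₁ : a₁ ≠ 0)
    (hq : ∀ m ∈ q.support, m 2 = 0)
    (hpd : p.natDegree ≤ d) (hqd : q.totalDegree ≤ d) (h0 : f.coord 0 = C a₂ * X 2 + q)
    (h1 : f.coord 1 = C a₁ * X 1 + Polynomial.aeval (X 0) p)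
    (h2 : f.coord 2 = C a₀ * X 0 + C b) :
    IsQuadraticOfDegreeLE d f.dynamicalDegree := by
  rcases Nat.eq_zero_or_pos p.natDegree with hp | hp
  · obtain ⟨e, rfl⟩ := Polynomial.natDegree_eq_zero.1 hp
    refine isQuadratic_of_affine_coord (p := Polynomial.C b) hf hd ha₁ hq hqd h0 (b := e) ?_
      (a₀ := a₀) ?_
    · rw [h1, Polynomial.aeval_C]
      rfl
    · rw [h2, Polynomial.aeval_C]
      rfl
  · obtain ⟨θ, hθ, hle, heq⟩ := exists_max_quadraticRoot q.support p.natDegree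
    rw [dynamicalDegree_eq_of_natDegree_pos hf h0 hq h1 hp (Or.inl ⟨a₀, b, h2⟩) hθ hle heq]
    rcases heq with rfl | ⟨m, hm, heq⟩
    · exact_mod_cast isQuadraticOfDegreeLE_natCast le_rfl hd
    · exact ⟨m 0, m 1, p.natDegree, (apply_add_apply_le_totalDegree hm).trans hqd, hpd,
        eq_quadraticRoot (by linarith) heq⟩

/-- The dynamical degree of a shift-like automorphism. -/
theorem exists_dynamicalDegree_of_shift (hf : IsUnit f) {e : k} (ha₀ : a₀ ≠ 0)
    (hq : ∀ m ∈ q.support, m 2 = 0) (h0 : f.coord 0 = C a₂ * X 2 + q)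
    (h1 : f.coord 1 = C a₀ * X 0 + C b) (h2 : f.coord 2 = C a₁ * X 1 + C e) :
    1 ≤ f.dynamicalDegree ∧
      (∀ m ∈ q.support, m 0 * f.dynamicalDegree + m 1 ≤ f.dynamicalDegree ^ 2) ∧
      (f.dynamicalDegree = 1 ∨
        ∃ m ∈ q.support, m 0 * f.dynamicalDegree + m 1 = f.dynamicalDegree ^ 2) := by
  obtain ⟨θ, hθ, hle, heq⟩ := exists_max_quadraticRoot q.support 1
  have hp : (Polynomial.C a₀ * Polynomial.X + Polynomial.C b).natDegree = 1 :=
    Polynomial.natDegree_linear ha₀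
  -- The second coordinate counts as a linear `p(x₁)` with `η = 0`, which gives `c = 1`.
  have h1' : f.coord 1 = C 0 * X 1 +
      Polynomial.aeval (X 0) (Polynomial.C a₀ * Polynomial.X + Polynomial.C b) := by
    rw [h1]
    simp [algebraMap_eq]
  have hdyn := dynamicalDegree_eq_of_natDegree_pos hf h0 hq h1' hp.ge (Or.inr ⟨hp, a₁, e, h2⟩) hθ
    (by rw [hp]; exact hle) (by rw [hp]; exact heq)
  rw [hdyn]
  simp only [Nat.cast_one, mul_one] at hle heq
  exact ⟨hθ, hle, heq⟩

/-- Since `x₁` is an affine function of the second coordinate of `f`, the conjugation `x₃ ↦ x₃ -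
P(x₂)` removes `p(x₁)` from the third. The result is shift-like with `Q = q + a₂ P`, still of degree
at most `d`. -/
theorem isQuadratic_of_rotate_inv (hf : IsUnit f) (hd : 1 ≤ d) (ha₀ : a₀ ≠ 0)
    (hq : ∀ m ∈ q.support, m 2 = 0)
    (hpd : p.natDegree ≤ d) (hqd : q.totalDegree ≤ d) (h0 : f.coord 0 = C a₂ * X 2 + q)
    (h1 : f.coord 1 = C a₀ * X 0 + C b)
    (h2 : f.coord 2 = C a₁ * X 1 + Polynomial.aeval (X 0) p) :
    IsQuadraticOfDegreeLE d f.dynamicalDegree := by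
  set y : MvPolynomial (Fin 3) k := C a₀⁻¹ * (X 1 - C b) with hy
  set P : MvPolynomial (Fin 3) k := Polynomial.aeval y p with hP
  let h : PolyEnd k 3 := ⟨![X 0, X 1, X 2 - P]⟩
  let h' : PolyEnd k 3 := ⟨![X 0, X 1, X 2 + P]⟩
  have hbind : ∀ g : Fin 3 → MvPolynomial (Fin 3) k,
      bind₁ g P = Polynomial.aeval (C a₀⁻¹ * (g 1 - C b)) p := by
    intro g
    rw [hP, bind₁_aeval, hy, map_mul, map_sub, bind₁_C_right, bind₁_C_right, bind₁_X_right]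
  have hhh' : h * h' = 1 := by
    refine PolyEnd.ext (funext fun i => ?_)
    rw [coord_mul, coord_one]
    fin_cases i
    · exact bind₁_X_right _ _
    · exact bind₁_X_right _ _
    · change bind₁ h'.coord (X 2 - P) = X 2
      rw [map_sub, bind₁_X_right, hbind]
      exact add_sub_cancel_right _ _
  have hh'h : h' * h = 1 := by
    refine PolyEnd.ext (funext fun i => ?_)
    rw [coord_mul, coord_one]
    fin_cases i
    · exact bind₁_X_right _ _
    · exact bind₁_X_right _ _
    · change bind₁ h.coord (X 2 + P) = X 2
      rw [map_add, bind₁_X_right, hbind]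
      exact sub_add_cancel _ _
  have hPw : WeightIn ![1, 1, 0] (Set.Iic (p.natDegree : ℝ)) P := by
    have hyw : WeightIn ![1, 1, 0] (Set.Iic 1) y :=
      ((weightIn_X 1 (by simp)).sub (weightIn_C b (by simp))).C_mul _
    simpa using hyw.aeval zero_le_one p
  have hP2 : ∀ m ∈ P.support, m 2 = 0 := by
    have hyw : WeightIn ![0, 0, 1] (Set.Iic 0) y :=
      ((weightIn_X 1 (by simp)).sub (weightIn_C b (by simp))).C_mul _
    intro m hm
    have := hyw.aeval le_rfl p m hm
    rw [weight_fin_three] at this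
    simpa using this
  obtain ⟨hu, hdyn⟩ := dynamicalDegree_eq_of_conj (by norm_num) hf hhh' hh'h rfl
  have hQ2 : ∀ m ∈ (q + C a₂ * P).support, m 2 = 0 := by
    intro m hm
    rcases Finset.mem_union.1 (support_add hm) with h | h
    · exact hq m h
    · rw [C_mul'] at h
      exact hP2 m (support_smul h)
  obtain ⟨hθ, -, heq⟩ := exists_dynamicalDegree_of_shift (a₀ := a₀) (a₁ := a₁) (a₂ := a₂) (b := b)
    (e := 0) hu ha₀ hQ2
    (by
      rw [coord_mul, coord_mul]
      change bind₁ h'.coord (bind₁ f.coord (X 0)) = _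
      rw [bind₁_X_right, h0, map_add, map_mul, bind₁_C_right, bind₁_X_right,
        bind₁_congr_of_apply_two_eq_zero hq (f := h'.coord) (g := X) rfl rfl, bind₁_X_left,
        AlgHom.id_apply]
      change C a₂ * (X 2 + P) + q = _
      ring)
    (by
      rw [coord_mul, coord_mul]
      change bind₁ h'.coord (bind₁ f.coord (X 1)) = _
      rw [bind₁_X_right, h1, map_add, map_mul, bind₁_C_right, bind₁_C_right, bind₁_X_right]
      rfl)
    (by
      rw [coord_mul, coord_mul]
      change bind₁ h'.coord (bind₁ f.coord (X 2 - P)) = _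
      have hx : C a₀⁻¹ * (f.coord 1 - C b) = X 0 := by
        rw [h1, add_sub_cancel_right, ← mul_assoc, ← C_mul, inv_mul_cancel₀ ha₀, C_1, one_mul]
      rw [map_sub, bind₁_X_right, hbind, hx, h2, add_sub_cancel_right, map_mul, bind₁_C_right,
        bind₁_X_right, C_0, add_zero]
      rfl)
  rw [hdyn] at hθ heq
  rcases heq with h | ⟨m, hm, heq⟩
  · rw [h]
    exact_mod_cast isQuadraticOfDegreeLE_natCast le_rfl hd
  · refine ⟨m 0, m 1, 1, ?_, hd, eq_quadraticRoot (by linarith) (by simpa using heq)⟩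
    rcases Finset.mem_union.1 (support_add hm) with h | h
    · exact (apply_add_apply_le_totalDegree h).trans hqd
    · rw [C_mul'] at h
      have := hPw m (support_smul h)
      rw [weight_fin_three] at this
      simp at this
      exact le_trans (by exact_mod_cast this) hpd

/-- Taking the first coordinate of `f` as a new variable gives a shift-like map with `Q = a₁ q(x₂,
a₁⁻¹(x₁ - p(x₂))) + p(x₁)`. Its degree is not bounded by `d`, so the coefficients of the quadratic
equation are bounded by comparing `θ` with `deg p`. -/
theorem isQuadratic_of_rotate (hf : IsUnit f) (hd : 1 ≤ d) (ha₁ : a₁ ≠ 0)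
    (hq : ∀ m ∈ q.support, m 2 = 0)
    (hpd : p.natDegree ≤ d) (hqd : q.totalDegree ≤ d)
    (h0 : f.coord 0 = C a₁ * X 1 + Polynomial.aeval (X 0) p) (h1 : f.coord 1 = C a₂ * X 2 + q)
    (h2 : f.coord 2 = C a₀ * X 0 + C b) :
    IsQuadraticOfDegreeLE d f.dynamicalDegree := by
  let h : PolyEnd k 3 := ⟨![C a₁ * X 1 + Polynomial.aeval (X 0) p, X 0, X 2]⟩
  let h' : PolyEnd k 3 := ⟨![X 1, C a₁⁻¹ * (X 0 - Polynomial.aeval (X 1) p), X 2]⟩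
  have hc0 : h.coord 0 = C a₁ * X 1 + Polynomial.aeval (X 0) p := rfl
  have hc1 : h.coord 1 = X 0 := rfl
  have hc2 : h.coord 2 = X 2 := rfl
  have hc0' : h'.coord 0 = X 1 := rfl
  have hc1' : h'.coord 1 = C a₁⁻¹ * (X 0 - Polynomial.aeval (X 1) p) := rfl
  have hc2' : h'.coord 2 = X 2 := rfl
  have hinv : C a₁ * C a₁⁻¹ = (1 : MvPolynomial (Fin 3) k) := by
    rw [← C_mul, mul_inv_cancel₀ ha₁, C_1]
  have hfh' : bind₁ h'.coord (C a₁ * X 1 + Polynomial.aeval (X 0) p) = X 0 := by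
    rw [map_add, map_mul, bind₁_C_right, bind₁_X_right, bind₁_aeval, bind₁_X_right, hc0', hc1',
      ← mul_assoc, hinv, one_mul, sub_add_cancel]
  have hhh' : h * h' = 1 := by
    refine PolyEnd.ext (funext fun i => ?_)
    rw [coord_mul, coord_one]
    fin_cases i
    · exact hfh'
    · exact bind₁_X_right _ _
    · exact bind₁_X_right _ _
  have hh'h : h' * h = 1 := by
    refine PolyEnd.ext (funext fun i => ?_)
    rw [coord_mul, coord_one]
    fin_cases i
    · exact bind₁_X_right _ _
    · change bind₁ h.coord (C a₁⁻¹ * (X 0 - Polynomial.aeval (X 1) p)) = X 1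
      rw [map_mul, map_sub, bind₁_C_right, bind₁_X_right, bind₁_aeval, bind₁_X_right, hc0, hc1,
        add_sub_cancel_right, ← mul_assoc, mul_comm (C a₁⁻¹), hinv, one_mul]
    · exact bind₁_X_right _ _
  obtain ⟨hu, hdyn⟩ := dynamicalDegree_eq_of_conj (by norm_num) hf hhh' hh'h rfl
  set Q : MvPolynomial (Fin 3) k := C a₁ * bind₁ h'.coord q + Polynomial.aeval (X 0) p with hQ
  have hX : ∀ (S : Set ℝ) (i : Fin 3) (w : Fin 3 → ℝ), w i ∈ S →
      WeightIn w S (X i : MvPolynomial (Fin 3) k) := fun S i w hi => weightIn_X i hi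
  have hno : ∀ {r : MvPolynomial (Fin 3) k}, WeightIn ![0, 0, 1] (Set.Iic 0) r →
      ∀ m ∈ r.support, m 2 = 0 := by
    intro r hr m hm
    have := hr m hm
    rw [weight_fin_three] at this
    simpa using this
  have haev : ∀ i : Fin 3, i ≠ 2 →
      WeightIn ![0, 0, 1] (Set.Iic 0) (Polynomial.aeval (X i : MvPolynomial (Fin 3) k) p) := by
    intro i hi
    have hw : (![0, 0, 1] : Fin 3 → ℝ) i = 0 := by fin_cases i <;> simp_all
    simpa using (hX (Set.Iic 0) i ![0, 0, 1] (by simp [hw])).aeval le_rfl p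
  have hQ2 : ∀ m ∈ Q.support, m 2 = 0 := by
    intro m hm
    rcases Finset.mem_union.1 (support_add hm) with h | h
    · rw [C_mul'] at h
      refine apply_two_eq_zero_of_bind₁ hq ?_ ?_ ?_ m (support_smul h)
      · exact hno (hX _ 1 _ (by simp))
      · exact hno (((hX _ 0 _ (by simp)).sub (haev 1 (by decide))).C_mul _)
      · intro m hm
        rw [hc2', support_X, Finset.mem_singleton] at hm
        subst hm
        simp
    · exact hno (haev 0 (by decide)) m h
  obtain ⟨hθ, hle, heq⟩ := exists_dynamicalDegree_of_shift (a₀ := 1) (a₁ := a₀) (a₂ := a₁ * a₂)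
    (b := 0) (e := b) hu one_ne_zero hQ2
    (by
      rw [coord_mul, coord_mul, hc0, map_add, map_mul, bind₁_C_right, bind₁_X_right, bind₁_aeval,
        bind₁_X_right, h0, h1, map_add, map_mul, map_add, bind₁_aeval, hfh', map_mul,
        bind₁_C_right, bind₁_C_right, bind₁_X_right, hc2', hQ, C_mul]
      ring)
    (by
      rw [coord_mul, coord_mul, hc1, bind₁_X_right, h0, hfh', C_1, C_0, one_mul, add_zero])
    (by
      rw [coord_mul, coord_mul, hc2, bind₁_X_right, h2, map_add, map_mul, bind₁_C_right,
        bind₁_C_right, bind₁_X_right, hc0'])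
  rw [hdyn] at hθ hle heq
  generalize f.dynamicalDegree = θ at hθ hle heq
  rcases heq with rfl | ⟨m₀, hm₀, heq⟩
  · exact_mod_cast isQuadraticOfDegreeLE_natCast le_rfl hd
  have hbQ : bind₁ h.coord Q = C a₁ * q + Polynomial.aeval (h.coord 0) p := by
    rw [hQ, map_add, map_mul, bind₁_C_right, bind₁_aeval, bind₁_X_right, bind₁_bind₁]
    have : (fun i => bind₁ h.coord (h'.coord i)) = X := congrArg PolyEnd.coord hh'h
    rw [this, bind₁_X_left, AlgHom.id_apply]
  have hq_eq : q = C a₁⁻¹ * (bind₁ h.coord Q - Polynomial.aeval (h.coord 0) p) := by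
    rw [hbQ, add_sub_cancel_right, ← mul_assoc, mul_comm (C a₁⁻¹), hinv, one_mul]
  rcases lt_trichotomy θ p.natDegree with hlt | rfl | hgt
  · have hc1R : (1 : ℝ) < p.natDegree := by linarith
    have hcpos : 1 ≤ p.natDegree := by exact_mod_cast hc1R.le
    have hs : p.leadingCoeff ≠ 0 := by
      rw [Polynomial.leadingCoeff_ne_zero]
      rintro rfl
      simp at hcpos
    set c : ℝ := (p.natDegree : ℝ) with hcdef
    -- If `θ < c`, then `c` is strictly beyond every root. Thus `Q ∘ h = a₁ q + p(h₀)` has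
    -- `x₁`-degree below `c ^ 2`, and the term `x₁ ^ (c ^ 2)` of `p(h₀)` must be cancelled by `q`.
    -- This gives `c ^ 2 ≤ d`.
    have hQlt : ∀ m ∈ Q.support, m 0 * c + m 1 < c ^ 2 := by
      intro m hm
      have e1 := hle m hm
      have e2 : (0 : ℝ) ≤ m 1 := Nat.cast_nonneg _
      have e3 : (m 0 : ℝ) ≤ θ := by
        by_contra! h
        nlinarith
      nlinarith [mul_pos (sub_pos.2 hlt) (by linarith : 0 < c + θ - m 0)]
    have hQw : WeightIn ![c, 1, 0] (Set.Iio (c ^ 2)) Q := by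
      intro m hm
      rw [weight_fin_three]
      simpa using hQlt m hm
    have hX0 : IsLead ![1, 0, 0] 1 (X 0 : MvPolynomial (Fin 3) k) (X 0) := isLead_X 0
    have hlead : IsLead ![1, 0, 0] c (h.coord 0) (C p.leadingCoeff * X 0 ^ p.natDegree) := by
      rw [hc0, add_comm]
      have := hX0.aeval one_pos p
      rw [mul_one] at this
      exact this.add_lt (weightIn_C_mul_X a₁ 1 (by simp; linarith))
    have hbw : WeightIn ![1, 0, 0] (Set.Iio (c ^ 2)) (bind₁ h.coord Q) := by
      refine hQw.bind₁ (isLowerSet_Iio _) fun i => ?_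
      fin_cases i
      · exact hlead.weightIn
      · exact hX _ 0 _ (by simp)
      · exact hX _ 2 _ (by simp)
    obtain ⟨m, hm, -, hmw⟩ := (hlead.aeval (by linarith) p).exists_mem_support
      (mul_ne_zero (C_ne_zero.2 hs)
        (pow_ne_zero _ (mul_ne_zero (C_ne_zero.2 hs) (pow_ne_zero _ (X_ne_zero 0)))))
    have hmq : m ∈ q.support := by
      have : Polynomial.aeval (h.coord 0) p = bind₁ h.coord Q - C a₁ * q := by
        rw [hbQ, add_sub_cancel_left]
      rw [this] at hm
      rcases Finset.mem_union.1 (support_sub _ _ _ hm) with h | h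
      · have := hbw m h
        rw [Set.mem_Iio, hmw, ← hcdef, pow_two] at this
        exact absurd this (lt_irrefl _)
      · rw [C_mul'] at h
        exact support_smul h
    have hdeg : c ^ 2 ≤ d := by
      rw [weight_fin_three] at hmw
      simp only [Matrix.cons_val_zero, Matrix.cons_val_one, Matrix.cons_val, mul_zero, mul_one,
        add_zero] at hmw
      have e1 : (m 0 : ℝ) ≤ d := by
        have := apply_add_apply_le_totalDegree hmq
        exact_mod_cast (by omega : m 0 ≤ d)
      rw [pow_two, hcdef, ← hmw]
      exact e1
    refine ⟨m₀ 0, m₀ 1, 1, ?_, hd, eq_quadraticRoot (by linarith) (by simpa using heq)⟩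
    have e1 := hQlt m₀ hm₀
    have e2 : (0 : ℝ) ≤ m₀ 0 := Nat.cast_nonneg _
    have : ((m₀ 0 + m₀ 1 : ℕ) : ℝ) ≤ d := by
      push_cast
      nlinarith
    exact_mod_cast this
  · exact isQuadraticOfDegreeLE_natCast (by exact_mod_cast hθ) hpd
  · have hθ0 : 0 ≤ θ := by linarith
    have hQw : WeightIn ![θ, 1, 0] (Set.Iic (θ ^ 2)) Q := by
      intro m hm
      rw [weight_fin_three]
      simpa using hle m hm
    have hh0 : WeightIn ![1, θ, 0] (Set.Iic θ) (h.coord 0) := by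
      refine (weightIn_C_mul_X a₁ 1 (by simp)).add
        (((hX (Set.Iic 1) 0 _ (by simp)).aeval zero_le_one p).mono (Set.Iic_subset_Iic.2 ?_))
      rw [mul_one]
      exact hgt.le
    have hqw : WeightIn ![1, θ, 0] (Set.Iic (θ ^ 2)) q := by
      rw [hq_eq]
      refine WeightIn.C_mul (WeightIn.sub (hQw.bind₁ (isLowerSet_Iic _) fun i => ?_)
        ((hh0.aeval hθ0 p).mono (Set.Iic_subset_Iic.2 ?_))) _
      · fin_cases i
        · exact hh0
        · exact hX _ 0 _ (by simp)
        · exact hX _ 2 _ (by simp)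
      · nlinarith
    -- If `θ > deg p`, then `h` and its inverse exchange the weights `(θ, 1, 0)` and `(1, θ, 0)`,
    -- and the terms in `p` have weight below `θ ^ 2`. So the extremal weight of `Q` is already
    -- attained by `q`.
    have hex : ∃ m ∈ q.support, Finsupp.weight ![1, θ, 0] m = θ ^ 2 := by
      by_contra! hne
      have hqlt : WeightIn ![1, θ, 0] (Set.Iio (θ ^ 2)) q := fun m hm =>
        lt_of_le_of_ne (hqw m hm) (hne m hm)
      have hQlt : WeightIn ![θ, 1, 0] (Set.Iio (θ ^ 2)) Q := by
        refine ((hqlt.bind₁ (isLowerSet_Iio _) fun i => ?_).C_mul _).add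
          (((hX (Set.Iic θ) 0 _ (by simp)).aeval hθ0 p).mono (Set.Iic_subset_Iio.2 ?_))
        · fin_cases i
          · exact hX _ 1 _ (by simp)
          · refine ((hX _ 0 _ (by simp)).sub
              (((hX (Set.Iic 1) 1 _ (by simp)).aeval zero_le_one p).mono
                (Set.Iic_subset_Iic.2 ?_))).C_mul _
            rw [mul_one]
            exact hgt.le
          · exact hX _ 2 _ (by simp)
        · nlinarith
      have := hQlt m₀ hm₀
      rw [weight_fin_three] at this
      simp only [Matrix.cons_val_zero, Matrix.cons_val_one, Matrix.cons_val, mul_zero, mul_one,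
        add_zero, Set.mem_Iio] at this
      linarith
    obtain ⟨m, hm, hmw⟩ := hex
    rw [weight_fin_three] at hmw
    simp only [Matrix.cons_val_zero, Matrix.cons_val_one, Matrix.cons_val, mul_zero, mul_one,
      add_zero] at hmw
    -- The exponents appear in reverse order because the weights of `x₁` and `x₂` were exchanged.
    refine ⟨m 1, m 0, 1, ?_, hd, eq_quadraticRoot (by linarith) ?_⟩
    · have := apply_add_apply_le_totalDegree hm
      omega
    · rw [← hmw]
      push_cast
      ring

theorem perm_fin_three_cases : ∀ σ : Equiv.Perm (Fin 3),
    (σ 0 = 0 ∧ σ 1 = 1 ∧ σ 2 = 2) ∨ (σ 0 = 0 ∧ σ 1 = 2 ∧ σ 2 = 1) ∨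
      (σ 0 = 1 ∧ σ 1 = 0 ∧ σ 2 = 2) ∨ (σ 0 = 1 ∧ σ 1 = 2 ∧ σ 2 = 0) ∨
      (σ 0 = 2 ∧ σ 1 = 0 ∧ σ 2 = 1) ∨ (σ 0 = 2 ∧ σ 1 = 1 ∧ σ 2 = 0) := by
  decide

/-- The dynamical degrees of affine-triangular automorphisms of degree at most `d`. -/
theorem IsAffineTriangular.isQuadratic (hf : IsUnit f) (h : f.IsAffineTriangular) (hd : 1 ≤ d)
    (hfd : f.degree ≤ d) : IsQuadraticOfDegreeLE d f.dynamicalDegree := by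
  obtain ⟨σ, τ, hτ, hu, hdeg, hdyn⟩ := h.exists_conj hf
  rw [hdyn]
  obtain ⟨a₀, a₁, a₂, b, p, q, ha₀, ha₁, ha₂, hq, h0, h1, h2⟩ := hτ.exists_eq hu
  have hτd := hdeg.trans hfd
  have hqd : q.totalDegree ≤ d := by
    have : q = τ.coord 2 - C a₂ * X 2 := by rw [h2, add_sub_cancel_left]
    rw [this]
    refine (totalDegree_sub _ _).trans (max_le ((totalDegree_coord_le τ 2).trans hτd) ?_)
    refine (totalDegree_mul _ _).trans ?_
    rwa [totalDegree_C, totalDegree_X]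
  have hpd : p.natDegree ≤ d := by
    rcases Nat.eq_zero_or_pos p.natDegree with hp | hp
    · omega
    have hX0 : IsLead ![1, 0, 0] 1 (X 0 : MvPolynomial (Fin 3) k) (X 0) := isLead_X 0
    have hlead : IsLead ![1, 0, 0] (p.natDegree * 1) (τ.coord 1)
        (C p.leadingCoeff * X 0 ^ p.natDegree) := by
      rw [h1, add_comm]
      exact (hX0.aeval one_pos p).add_lt (weightIn_C_mul_X a₁ 1 (by simpa using hp))
    have hs : p.leadingCoeff ≠ 0 := by
      rw [Polynomial.leadingCoeff_ne_zero]
      rintro rfl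
      simp at hp
    obtain ⟨m, hm, -, hmw⟩ := hlead.exists_mem_support
      (mul_ne_zero (C_ne_zero.2 hs) (pow_ne_zero _ (X_ne_zero 0)))
    rw [weight_fin_three] at hmw
    simp only [Matrix.cons_val_zero, Matrix.cons_val_one, Matrix.cons_val, mul_zero, mul_one,
      add_zero, Nat.cast_inj] at hmw
    have e1 := apply_add_apply_le_totalDegree hm
    have e2 := (totalDegree_coord_le τ 1).trans hτd
    omega
  have hfu : IsUnit (ofPerm k σ * τ) := (isUnit_ofPerm σ).mul hu
  have hc : ∀ {i j r}, σ i = j → τ.coord j = r → (ofPerm k σ * τ).coord i = r := by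
    rintro i _ _ rfl rfl
    exact coord_ofPerm_mul σ τ i
  rcases perm_fin_three_cases σ with ⟨s0, s1, s2⟩ | ⟨s0, s1, s2⟩ | ⟨s0, s1, s2⟩ | ⟨s0, s1, s2⟩ |
    ⟨s0, s1, s2⟩ | ⟨s0, s1, s2⟩
  · rw [dynamicalDegree_eq_one_of_triangular hfu hq (hc s0 h0) (hc s1 h1) (hc s2 h2)]
    exact_mod_cast isQuadraticOfDegreeLE_natCast le_rfl hd
  · exact isQuadratic_of_swap_one_two hfu hd ha₀ hq hqd (hc s0 h0) (hc s1 h2) (hc s2 h1)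
  · rw [dynamicalDegree_eq_max_natDegree hfu hq (hc s0 h1) (hc s1 h0) (hc s2 h2)]
    exact isQuadraticOfDegreeLE_natCast (le_max_left _ _) (max_le hd hpd)
  · exact isQuadratic_of_rotate hfu hd ha₁ hq hpd hqd (hc s0 h1) (hc s1 h2) (hc s2 h0)
  · exact isQuadratic_of_rotate_inv hfu hd ha₀ hq hpd hqd (hc s0 h2) (hc s1 h0) (hc s2 h1)
  · exact isQuadratic_of_swap_zero_two hfu hd ha₁ hq hpd hqd (hc s0 h2) (hc s1 h1) (hc s2 h0)

/-! ### The explicit examples -/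

theorem isUnit_of_coord_eq {τ : PolyEnd k 3} {p : Polynomial k} {q : MvPolynomial (Fin 3) k}
    (hq : ∀ m ∈ q.support, m 2 = 0) (h0 : τ.coord 0 = X 0)
    (h1 : τ.coord 1 = X 1 + Polynomial.aeval (X 0) p) (h2 : τ.coord 2 = X 2 + q) :
    IsUnit τ := by
  set y : MvPolynomial (Fin 3) k := X 1 - Polynomial.aeval (X 0) p with hy
  let ρ : PolyEnd k 3 := ⟨![X 0, y, X 2 - bind₁ ![X 0, y, 0] q]⟩
  have hτy : bind₁ τ.coord y = X 1 := by
    rw [hy, map_sub, bind₁_X_right, bind₁_aeval, bind₁_X_right, h0, h1, add_sub_cancel_right]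
  refine ⟨⟨τ, ρ, PolyEnd.ext (funext fun i => ?_), PolyEnd.ext (funext fun i => ?_)⟩, rfl⟩
  · rw [coord_mul, coord_one]
    fin_cases i
    · change bind₁ ρ.coord (τ.coord 0) = X 0
      rw [h0, bind₁_X_right]
      rfl
    · change bind₁ ρ.coord (τ.coord 1) = X 1
      rw [h1, map_add, bind₁_X_right, bind₁_aeval, bind₁_X_right]
      exact sub_add_cancel _ _
    · change bind₁ ρ.coord (τ.coord 2) = X 2
      rw [h2, map_add, bind₁_X_right,
        bind₁_congr_of_apply_two_eq_zero hq (f := ρ.coord) (g := ![X 0, y, 0]) rfl rfl]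
      exact sub_add_cancel _ _
  · rw [coord_mul, coord_one]
    fin_cases i
    · exact (bind₁_X_right _ _).trans h0
    · exact hτy
    · change bind₁ τ.coord (X 2 - bind₁ ![X 0, y, 0] q) = X 2
      rw [map_sub, bind₁_X_right, bind₁_bind₁, h2,
        bind₁_congr_of_apply_two_eq_zero hq (g := X), bind₁_X_left, AlgHom.id_apply,
        add_sub_cancel_right]
      · exact (bind₁_X_right _ _).trans h0
      · exact hτy

theorem isAffineTriangular_of_coord_eq {f : PolyEnd k 3} (σ : Equiv.Perm (Fin 3))
    {p : Polynomial k} {q : MvPolynomial (Fin 3) k} (hq : ∀ m ∈ q.support, m 2 = 0)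
    (h : ∀ i, f.coord i = ![X 0, X 1 + Polynomial.aeval (X 0) p, X 2 + q] (σ i)) :
    IsUnit f ∧ f.IsAffineTriangular := by
  let τ : PolyEnd k 3 := ⟨![X 0, X 1 + Polynomial.aeval (X 0) p, X 2 + q]⟩
  have hf : f = ofPerm k σ * τ := by
    refine PolyEnd.ext (funext fun i => ?_)
    rw [coord_ofPerm_mul, h i]
  have hτ : IsUnit τ := isUnit_of_coord_eq hq rfl rfl rfl
  refine ⟨hf ▸ (isUnit_ofPerm σ).mul hτ, ofPerm k σ, τ, isAffineAut_ofPerm (by norm_num) σ, ?_, hf⟩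
  have hX : ∀ i j : Fin 3, j ≤ i → (X j : MvPolynomial (Fin 3) k) ∈ supported k (Set.Iic i) :=
    fun i j hij => X_mem_supported.2 hij
  intro i
  fin_cases i
  · exact hX 0 0 le_rfl
  · exact Subalgebra.add_mem _ (hX 1 1 le_rfl)
      (Algebra.adjoin_le (Set.singleton_subset_iff.2 (hX 1 0 (by decide)))
        (Polynomial.aeval_mem_adjoin_singleton k _))
  · refine Subalgebra.add_mem _ (hX 2 2 le_rfl) (mem_supported.2 fun i _ => ?_)
    exact Set.mem_Iic.2 (by change i ≤ 2; omega)

theorem support_X_pow_mul_X_pow {a b : ℕ} :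
    (X 0 ^ a * X 1 ^ b : MvPolynomial (Fin 3) k).support =
      {Finsupp.single 0 a + Finsupp.single 1 b} := by
  classical
  rw [X_pow_eq_monomial, X_pow_eq_monomial, monomial_mul, one_mul, support_monomial,
    if_neg one_ne_zero]

theorem mem_support_X_pow_mul_X_pow {a b : ℕ} {m : Fin 3 →₀ ℕ} :
    m ∈ (X 0 ^ a * X 1 ^ b : MvPolynomial (Fin 3) k).support ↔ m 0 = a ∧ m 1 = b ∧ m 2 = 0 := by
  rw [support_X_pow_mul_X_pow, Finset.mem_singleton]
  constructor
  · rintro rfl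
    simp
  · rintro ⟨rfl, rfl, h⟩
    ext i
    fin_cases i <;> simp [h]

theorem swap_example_spec (a b c : ℕ) (hl : quadraticRoot a b c ≠ 0) {f : PolyEnd k 3}
    (hf : f = ⟨![X 2 + X 0 ^ a * X 1 ^ b, X 1 + X 0 ^ c, X 0]⟩) :
    IsUnit f ∧ f.IsAffineTriangular ∧ f.dynamicalDegree = quadraticRoot a b c := by
  have hq : ∀ m ∈ (X 0 ^ a * X 1 ^ b : MvPolynomial (Fin 3) k).support, m 2 = 0 := fun m hm =>
    (mem_support_X_pow_mul_X_pow.1 hm).2.2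
  obtain ⟨m, hm⟩ : ∃ m, m ∈ (X 0 ^ a * X 1 ^ b : MvPolynomial (Fin 3) k).support := by
    rw [support_X_pow_mul_X_pow]
    exact ⟨_, Finset.mem_singleton_self _⟩
  have h0 : f.coord 0 = C 1 * X 2 + X 0 ^ a * X 1 ^ b := by rw [hf, C_1, one_mul]; rfl
  have h1 : f.coord 1 = C 1 * X 1 + Polynomial.aeval (X 0) (Polynomial.X ^ c : Polynomial k) := by
    rw [hf, C_1, one_mul, Polynomial.aeval_X_pow]
    rfl
  have h2 : f.coord 2 = C 1 * X 0 + C 0 := by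
    rw [hf, C_1, one_mul, C_0, add_zero]
    rfl
  obtain ⟨hu, hat⟩ := isAffineTriangular_of_coord_eq (f := f) (Equiv.swap 0 2)
    (p := Polynomial.X ^ c) hq (by
      intro i
      fin_cases i
      · rw [hf]; rfl
      · rw [hf, Polynomial.aeval_X_pow]; rfl
      · rw [hf]; rfl)
  refine ⟨hu, hat, ?_⟩
  -- For `c = 0` the second coordinate is `x₂ + 1`, which belongs to the affine family; the root is
  -- then `a`, the exponent of `x₁`.
  rcases Nat.eq_zero_or_pos c with rfl | hc
  · have hla : quadraticRoot a b 0 = a := by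
      unfold quadraticRoot
      rw [Nat.cast_zero, mul_zero, add_zero, Real.sqrt_sq (Nat.cast_nonneg a)]
      ring
    rw [hla] at hl ⊢
    have ha : 1 ≤ a := Nat.one_le_iff_ne_zero.2 (Nat.cast_ne_zero.1 hl)
    have h1' : f.coord 1 = C 1 * X 1 + C 1 := by
      rw [h1, pow_zero, C_1, map_one]
    refine dynamicalDegree_eq_of_affine (p := 0) (a := 1) hu one_ne_zero h0 hq h1' ?_ ha
      (fun m hm => (mem_support_X_pow_mul_X_pow.1 hm).1.le)
      (Or.inr ⟨m, hm, (mem_support_X_pow_mul_X_pow.1 hm).1⟩)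
    rw [h2, C_0, map_zero]
  · have heq : ∀ m ∈ (X 0 ^ a * X 1 ^ b : MvPolynomial (Fin 3) k).support,
        m 0 * quadraticRoot a b c + m 1 * (Polynomial.X ^ c : Polynomial k).natDegree =
          quadraticRoot a b c ^ 2 := by
      intro m hm
      obtain ⟨e0, e1, -⟩ := mem_support_X_pow_mul_X_pow.1 hm
      rw [e0, e1, Polynomial.natDegree_X_pow, quadraticRoot_sq]
    exact dynamicalDegree_eq_of_natDegree_pos hu h0 hq h1
      (by rwa [Polynomial.natDegree_X_pow]) (Or.inl ⟨1, 0, h2⟩) (one_le_quadraticRoot hl)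
      (fun m hm => (heq m hm).le) (Or.inr ⟨m, hm, heq m hm⟩)

theorem shift_example_spec (a b c : ℕ) (hl : quadraticRoot a b c ≠ 0) {f : PolyEnd k 3}
    (hf : f = ⟨![X 2 + X 0 ^ a * X 1 ^ (b * c), X 0, X 1]⟩) :
    IsUnit f ∧ f.IsAffineTriangular ∧ f.dynamicalDegree = quadraticRoot a b c := by
  have hq : ∀ m ∈ (X 0 ^ a * X 1 ^ (b * c) : MvPolynomial (Fin 3) k).support, m 2 = 0 :=
    fun m hm => (mem_support_X_pow_mul_X_pow.1 hm).2.2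
  obtain ⟨m, hm⟩ : ∃ m, m ∈ (X 0 ^ a * X 1 ^ (b * c) : MvPolynomial (Fin 3) k).support := by
    rw [support_X_pow_mul_X_pow]
    exact ⟨_, Finset.mem_singleton_self _⟩
  have h0 : f.coord 0 = C 1 * X 2 + X 0 ^ a * X 1 ^ (b * c) := by rw [hf, C_1, one_mul]; rfl
  have h1 : f.coord 1 = C 0 * X 1 + Polynomial.aeval (X 0) (Polynomial.X : Polynomial k) := by
    rw [hf, C_0, zero_mul, zero_add, Polynomial.aeval_X]
    rfl
  have h2 : f.coord 2 = C 1 * X 1 + C 0 := by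
    rw [hf, C_1, one_mul, C_0, add_zero]
    rfl
  obtain ⟨hu, hat⟩ := isAffineTriangular_of_coord_eq (f := f) (finRotate 3)⁻¹ (p := 0) hq (by
    intro i
    rw [hf, map_zero, add_zero]
    fin_cases i <;> rfl)
  refine ⟨hu, hat, ?_⟩
  -- The equation `t² = a t + b c` is also the one for exponents `a`, `b * c` and a linear second
  -- coordinate.
  have heq : ∀ m ∈ (X 0 ^ a * X 1 ^ (b * c) : MvPolynomial (Fin 3) k).support,
      m 0 * quadraticRoot a b c + m 1 * (Polynomial.X : Polynomial k).natDegree =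
        quadraticRoot a b c ^ 2 := by
    intro m hm
    obtain ⟨e0, e1, -⟩ := mem_support_X_pow_mul_X_pow.1 hm
    rw [e0, e1, Polynomial.natDegree_X, quadraticRoot_sq]
    push_cast
    ring
  exact dynamicalDegree_eq_of_natDegree_pos hu h0 hq h1 Polynomial.natDegree_X.ge
    (Or.inr ⟨Polynomial.natDegree_X, 1, 0, h2⟩) (one_le_quadraticRoot hl)
    (fun m hm => (heq m hm).le) (Or.inr ⟨m, hm, heq m hm⟩)

theorem degree_swap_example_le {a b c d : ℕ} (hd : 1 ≤ d) (hab : a + b ≤ d) (hc : c ≤ d) :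
    (⟨![X 2 + X 0 ^ a * X 1 ^ b, X 1 + X 0 ^ c, X 0]⟩ : PolyEnd k 3).degree ≤ d := by
  refine Finset.sup_le fun i _ => ?_
  fin_cases i
  · change (X 2 + X 0 ^ a * X 1 ^ b : MvPolynomial (Fin 3) k).totalDegree ≤ d
    refine (totalDegree_add _ _).trans (max_le (by rwa [totalDegree_X]) ?_)
    refine (totalDegree_mul _ _).trans ?_
    rwa [totalDegree_X_pow, totalDegree_X_pow]
  · change (X 1 + X 0 ^ c : MvPolynomial (Fin 3) k).totalDegree ≤ d
    exact (totalDegree_add _ _).trans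
      (max_le (by rwa [totalDegree_X]) (by rwa [totalDegree_X_pow]))
  · change (X 0 : MvPolynomial (Fin 3) k).totalDegree ≤ d
    rwa [totalDegree_X]

end PolyEnd

theorem theorem1 (k : Type*) [Field k] (d : ℕ) (hd : 2 ≤ d) :
    {l : ℝ | ∃ f : PolyEnd k 3,
        IsUnit f ∧ f.IsAffineTriangular ∧ f.degree ≤ d ∧ f.dynamicalDegree = l} =
      {l : ℝ | ∃ a b c : ℕ, a + b ≤ d ∧ c ≤ d ∧
        l = ((a : ℝ) + √((a : ℝ) ^ 2 + 4 * (b : ℝ) * (c : ℝ))) / 2} \ {0} ∧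
    ∀ (a b c : ℕ) (l : ℝ),
      l = ((a : ℝ) + √((a : ℝ) ^ 2 + 4 * (b : ℝ) * (c : ℝ))) / 2 → l ≠ 0 →
      ∀ f ∈ ({⟨![MvPolynomial.X 2 + MvPolynomial.X 0 ^ a * MvPolynomial.X 1 ^ b,
                MvPolynomial.X 1 + MvPolynomial.X 0 ^ c,
                MvPolynomial.X 0]⟩,
              ⟨![MvPolynomial.X 2 + MvPolynomial.X 0 ^ a * MvPolynomial.X 1 ^ (b * c),
                MvPolynomial.X 0,
                MvPolynomial.X 1]⟩} : Set (PolyEnd k 3)),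
        IsUnit f ∧ f.IsAffineTriangular ∧ f.dynamicalDegree = l := by
  refine ⟨Set.ext fun l => ⟨?_, ?_⟩, ?_⟩
  · rintro ⟨f, hf, hat, hfd, rfl⟩
    refine ⟨hat.isQuadratic hf (by omega) hfd, ?_⟩
    have := PolyEnd.one_le_dynamicalDegree (by norm_num) hf
    rw [Set.mem_singleton_iff]
    linarith
  · rintro ⟨⟨a, b, c, hab, hc, hl⟩, hl0⟩
    subst hl
    obtain ⟨hu, hat, hdyn⟩ := PolyEnd.swap_example_spec (k := k) a b c hl0 rfl
    exact ⟨_, hu, hat, PolyEnd.degree_swap_example_le (by omega) hab hc, hdyn⟩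
  · rintro a b c l rfl hl0 f (hf | hf)
    · exact PolyEnd.swap_example_spec a b c hl0 hf
    · exact PolyEnd.shift_example_spec a b c hl0 hf
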